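/- Let $\mathbb{T}$ be the unit circle and $L^2(\mathbb{T})$ the Hilbert space of square integrable complex functions with respect to normalised arc length $\frac{d\xi}{2\pi}$. Let $H^2\subset L^2(\mathbb{T})$ be the Hardy space (functions whose Fourier coefficients of negative order vanish) and $H^\infty=H^2\cap L^\infty$. Let $d\ge 1$, let $\lambda_1,\dots,\lambda_d$ be points of the open unit disc (not necessarily distinct) and let $B(z)=\prod_{i=1}^d\frac{z-\lambda_i}{1-\overline{\lambda_i}z}$ be the finite Blaschke product with these zeros. For $n\in\mathbb{N}$ let $K_{B^n}=H^2\cap(B^nH^2)^{\perp}$, a finite dimensional subspace of $H^\infty$. For $\phi\in L^2(\mathbb{T})$ let $T_\phi g=P_{H^2}(\phi g)$ for $g\in H^\infty$, and let $T_{\phi,K_{B^n}}f=P_{K_{B^n}}T_\phi f$ for $f\in K_{B^n}$, a linear operator on $K_{B^n}$. Let $M_1$ be the closed linear span of $\{B^t:t\in\mathbb{Z}\}$ in $L^2(\mathbb{T})$. Let $\phi\in M_1$. Then there is exactly one family $(a_n)_{n\in\mathbb{Z}}$ of complex numbers such that $\phi=\sum_{n\in\mathbb{Z}}a_nB^n$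 (unconditional convergence in $L^2(\mathbb{T})$); for this family the series $\varphi(z)=\sum_{n\in\mathbb{Z}}a_nz^n$ converges unconditionally in $L^2(\mathbb{T})$, and the following hold. 1. $T_\phi$ is distributed as $|\varphi|$ in the sense of the singular values relative to the sequence of model spaces $(K_{B^n})_{n\in\mathbb{N}}$: for every continuous function $G:\mathbb{R}\to\mathbb{C}$ with compact support, $$\lim_{n\to\infty}\frac{1}{\dim K_{B^n}}\sum_{k=1}^{\dim K_{B^n}}G\bigl(\sigma_k(T_{\phi,K_{B^n}})\bigr)=\frac1{2\pi}\int_{\mathbb{T}}G(|\varphi(\xi)|)\,d\xi,$$ where $\sigma_k(T_{\phi,K_{B^n}})$, $1\le k\le\dim K_{B^n}$, are the singular values of $T_{\phi,K_{B^n}}$ repeated according to multiplicity. 2. If $\phi$ is real valued (almost everywhere), then $T_\phi$ is distributed as $\varphi$ in the sense of the eigenvalues relative to $(K_{B^n})_{n\in\mathbb{N}}$: for every continuous function $G:\mathbb{C}\to\mathbb{C}$ with compact support, $$\lim_{n\to\infty}\frac{1}{\dim K_{B^n}}\sum_{k=1}^{\dim K_{B^n}}G\bigl(\lambda_k(T_{\phi,K_{B^n}})\bigr)=\frac1{2\pi}\int_{\mathbb{T}}G(\varphi(\xi))\,d\xi,$$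 where $\lambda_k(T_{\phi,K_{B^n}})$, $1\le k\le\dim K_{B^n}$, are the eigenvalues of $T_{\phi,K_{B^n}}$ repeated according to algebraic multiplicity. -/

import Mathlib

open MeasureTheory Filter Topology ComplexConjugate
open scoped ENNReal Complex.UnitDisc InnerProductSpace

noncomputable section

namespace SzegoModel

instance instFactTwoPiPos : Fact (0 < 2 * Real.pi) := ⟨Real.two_pi_pos⟩

/-- The unit circle, parametrised by `t ↦ e^{it}`, `t ∈ ℝ / 2πℤ`. -/
abbrev Torus : Type := AddCircle (2 * Real.pi)

/-- Normalised arc length `dξ / 2π` on the circle. -/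
abbrev arc : Measure Torus := AddCircle.haarAddCircle

/-- `L²(𝕋)` for normalised arc length. -/
abbrev L2 : Type := Lp ℂ 2 arc

/-- The point `e^{it}` of the unit circle. -/
def pt (t : Torus) : ℂ := (AddCircle.toCircle t : ℂ)

lemma norm_pt (t : Torus) : ‖pt t‖ = 1 := Circle.norm_coe _

lemma continuous_pt : Continuous pt :=
  continuous_induced_dom.comp AddCircle.continuous_toCircle

lemma pt_ne_zero (t : Torus) : pt t ≠ 0 := by
  intro h; have := norm_pt t; simp [h] at this

lemma conj_pt (t : Torus) : conj (pt t) * pt t = 1 := by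
  rw [mul_comm, Complex.mul_conj, Complex.normSq_eq_norm_sq, norm_pt]; simp

lemma fourier_eq_zpow (n : ℤ) (t : Torus) : fourier n t = pt t ^ n := by
  simp [fourier_apply, AddCircle.toCircle_zsmul, pt]

/-! ### Hardy space -/

lemma fourierCoeff_eq_repr (f : L2) (n : ℤ) :
    fourierCoeff f n = fourierBasis.repr f n := (fourierBasis_repr f n).symm

/-- The Hardy space `H²`: the functions in `L²(𝕋)` whose Fourier coefficients of negative order
vanish. -/
def hardy : Submodule ℂ L2 where
  carrier := {f | ∀ n : ℤ, n < 0 → fourierCoeff f n = 0}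
  add_mem' {f g} hf hg n hn := by
    have h1 := hf n hn
    have h2 := hg n hn
    rw [fourierCoeff_eq_repr] at h1 h2 ⊢
    simp [h1, h2]
  zero_mem' n _ := by rw [fourierCoeff_eq_repr]; simp
  smul_mem' c f hf n hn := by
    have h1 := hf n hn
    rw [fourierCoeff_eq_repr] at h1 ⊢
    simp [h1]

lemma mem_hardy {f : L2} : f ∈ hardy ↔ ∀ n : ℤ, n < 0 → fourierCoeff f n = 0 := Iff.rfl

lemma isClosed_hardy : IsClosed (hardy : Set L2) := by
  have : (hardy : Set L2) = ⋂ n : ℤ, ⋂ _ : n < 0, {f : L2 | ⟪fourierBasis n, f⟫_ℂ = 0} := by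
    ext f
    simp [mem_hardy, fourierCoeff_eq_repr, HilbertBasis.repr_apply_apply]
  rw [this]
  refine isClosed_iInter fun n => isClosed_iInter fun _ => ?_
  exact isClosed_eq (by fun_prop) continuous_const

instance instCompleteHardy : CompleteSpace hardy := isClosed_hardy.completeSpace_coe

/-- `H^∞ = H² ∩ L^∞`. -/
def hardyInf : Submodule ℂ L2 where
  carrier := {f | f ∈ hardy ∧ MemLp f ∞ arc}
  add_mem' {f g} hf hg :=
    ⟨hardy.add_mem hf.1 hg.1, (hf.2.add hg.2).ae_eq (Lp.coeFn_add f g).symm⟩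
  zero_mem' := ⟨hardy.zero_mem, (MemLp.zero' (ε := ℂ)).ae_eq (Lp.coeFn_zero ℂ 2 arc).symm⟩
  smul_mem' c f hf :=
    ⟨hardy.smul_mem c hf.1, (hf.2.const_smul c).ae_eq (Lp.coeFn_smul c f).symm⟩

lemma memLp_mul (ϕ : L2) {g : Torus → ℂ} (hg : MemLp g ∞ arc) :
    MemLp (fun t => ϕ t * g t) 2 arc :=
  hg.mul' (Lp.memLp ϕ)

/-- The Toeplitz operator `T_ϕ g = P_{H²}(ϕ g)` with symbol `ϕ ∈ L²(𝕋)`, defined on `H^∞`. -/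
def toeplitz (ϕ : L2) : hardyInf →ₗ[ℂ] hardy where
  toFun g := hardy.orthogonalProjectionOnto ((memLp_mul ϕ g.2.2).toLp _)
  map_add' f g := by
    rw [← map_add, ← MemLp.toLp_add]
    congr 1
    refine MemLp.toLp_congr _ _ ?_
    filter_upwards [Lp.coeFn_add (f : L2) g] with t ht
    simp only [Submodule.coe_add, ht, Pi.add_apply, mul_add]
  map_smul' c g := by
    rw [RingHom.id_apply, ← map_smul, ← MemLp.toLp_const_smul]
    congr 1
    refine MemLp.toLp_congr _ _ ?_
    filter_upwards [Lp.coeFn_smul c (g : L2)] with t ht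
    simp only [Submodule.coe_smul, ht, Pi.smul_apply, smul_eq_mul]
    ring

/-! ### Model spaces -/

/-- `θ H² = {θ g : g ∈ H²}` (inside `L²(𝕋)`). -/
def mulHardy (θ : Torus → ℂ) : Submodule ℂ L2 where
  carrier := {h | ∃ g ∈ hardy, h =ᵐ[arc] fun t => θ t * g t}
  add_mem' := by
    rintro h₁ h₂ ⟨g₁, hg₁, e₁⟩ ⟨g₂, hg₂, e₂⟩
    refine ⟨g₁ + g₂, hardy.add_mem hg₁ hg₂, ?_⟩
    filter_upwards [e₁, e₂, Lp.coeFn_add h₁ h₂, Lp.coeFn_add g₁ g₂] with t a b c e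
    rw [c, e, Pi.add_apply, Pi.add_apply, a, b, mul_add]
  zero_mem' := by
    refine ⟨0, hardy.zero_mem, ?_⟩
    filter_upwards [Lp.coeFn_zero ℂ 2 arc] with t a
    rw [a, Pi.zero_apply, mul_zero]
  smul_mem' := by
    rintro c h ⟨g, hg, e⟩
    refine ⟨c • g, hardy.smul_mem c hg, ?_⟩
    filter_upwards [e, Lp.coeFn_smul c h, Lp.coeFn_smul c g] with t a b e
    rw [b, e, Pi.smul_apply, Pi.smul_apply, a, smul_eq_mul, smul_eq_mul, mul_left_comm]

/-- The model space `K_θ = H² ⊖ θ H² = H² ∩ (θ H²)^⊥`. -/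
def modelSpace (θ : Torus → ℂ) : Submodule ℂ L2 := hardy ⊓ (mulHardy θ)ᗮ

/-- The compression `T_{ϕ,K} = P_K T_ϕ P_K` to a finite dimensional subspace `K ⊆ H^∞` of the
Toeplitz operator with symbol `ϕ ∈ L²(𝕋)`, as an operator on `K`. -/
def compression (ϕ : L2) (K : Submodule ℂ L2) [FiniteDimensional ℂ K] (hK : K ≤ hardyInf) :
    K →ₗ[ℂ] K :=
  (K.orthogonalProjectionOnto : L2 →ₗ[ℂ] K) ∘ₗ hardy.subtype ∘ₗ toeplitz ϕ ∘ₗ Submodule.inclusion hK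

/-! ### Finite Blaschke products -/

/-- The finite Blaschke product `B(z) = ∏ (z - λᵢ) / (1 - conj λᵢ z)` with zeros `λ₁, …, λ_d`
in the open unit disc, repeated according to multiplicity. -/
def blaschke {d : ℕ} (lam : Fin d → 𝔻) (z : ℂ) : ℂ :=
  ∏ i, (z - lam i) / (1 - conj (lam i : ℂ) * z)

lemma den_ne_zero (l : 𝔻) (t : Torus) : 1 - conj (l : ℂ) * pt t ≠ 0 := by
  intro h
  have h1 : ‖conj (l : ℂ) * pt t‖ = 1 := by rw [← sub_eq_zero.1 h]; simp
  rw [norm_mul, norm_pt, mul_one, RCLike.norm_conj] at h1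
  exact absurd h1 l.norm_lt_one.ne

lemma conj_num (l : 𝔻) (t : Torus) :
    conj (pt t - (l : ℂ)) * pt t = 1 - conj (l : ℂ) * pt t := by
  rw [map_sub, sub_mul, conj_pt]

lemma num_ne_zero (l : 𝔻) (t : Torus) : pt t - (l : ℂ) ≠ 0 := by
  intro h
  have := conj_num l t
  rw [h] at this
  exact den_ne_zero l t (by rw [← this]; simp)

lemma blaschke_ne_zero {d : ℕ} (lam : Fin d → 𝔻) (t : Torus) : blaschke lam (pt t) ≠ 0 :=
  Finset.prod_ne_zero_iff.2 fun i _ => div_ne_zero (num_ne_zero _ _) (den_ne_zero _ _)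

/-- The powers `Bⁿ`, `n ∈ ℤ`, as continuous functions on the circle. -/
def blaschkePow {d : ℕ} (lam : Fin d → 𝔻) (n : ℤ) : C(Torus, ℂ) where
  toFun t := blaschke lam (pt t) ^ n
  continuous_toFun := by
    refine Continuous.zpow₀ ?_ n fun t => Or.inl (blaschke_ne_zero lam t)
    unfold blaschke
    refine continuous_finsetProd _ fun _ _ => ?_
    exact (continuous_pt.sub continuous_const).div
      (continuous_const.sub (continuous_const.mul continuous_pt)) fun t => den_ne_zero _ t

/-- The powers `Bⁿ`, `n ∈ ℤ`, as elements of `L²(𝕋)`. -/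
def blaschkeLp {d : ℕ} (lam : Fin d → 𝔻) (n : ℤ) : L2 :=
  ContinuousMap.toLp 2 arc ℂ (blaschkePow lam n)

/-- The space `M₁`, the closed linear span in `L²(𝕋)` of the powers `Bⁿ`, `n ∈ ℤ`. -/
def spaceM₁ {d : ℕ} (lam : Fin d → 𝔻) : Submodule ℂ L2 :=
  (Submodule.span ℂ (Set.range (blaschkeLp lam))).topologicalClosure

/-- The model space `K_{Bⁿ}`. -/
def blaschkeModel {d : ℕ} (lam : Fin d → 𝔻) (n : ℕ) : Submodule ℂ L2 :=
  modelSpace (blaschkePow lam n)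

/-! ### The spaces `K_{Bⁿ}` are finite dimensional and contained in `H^∞`

If `f ∈ K_{Bⁿ}` and `q` is the denominator of `Bⁿ`, then `q f` is a polynomial of degree less
than `n d`. -/

/-- The denominator of `Bⁿ`, as a polynomial. -/
def denPoly {d : ℕ} (lam : Fin d → 𝔻) (n : ℕ) : Polynomial ℂ :=
  ∏ i, (1 - Polynomial.C (conj (lam i : ℂ)) * Polynomial.X) ^ n

/-- The numerator of `Bⁿ`, as a polynomial. -/
def numPoly {d : ℕ} (lam : Fin d → 𝔻) (n : ℕ) : Polynomial ℂ :=
  ∏ i, (Polynomial.X - Polynomial.C (lam i : ℂ)) ^ n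

lemma denPoly_ne_zero {d : ℕ} (lam : Fin d → 𝔻) (n : ℕ) (t : Torus) :
    (denPoly lam n).eval (pt t) ≠ 0 := by
  simp only [denPoly, Polynomial.eval_prod, Polynomial.eval_pow, Polynomial.eval_sub,
    Polynomial.eval_one, Polynomial.eval_mul, Polynomial.eval_C, Polynomial.eval_X]
  exact Finset.prod_ne_zero_iff.2 fun i _ => pow_ne_zero _ (den_ne_zero _ t)

lemma blaschkePow_mul_den {d : ℕ} (lam : Fin d → 𝔻) (n : ℕ) (t : Torus) :
    blaschkePow lam n t * (denPoly lam n).eval (pt t) = (numPoly lam n).eval (pt t) := by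
  simp only [blaschkePow, ContinuousMap.coe_mk, blaschke, denPoly, numPoly, Polynomial.eval_prod,
    Polynomial.eval_pow, Polynomial.eval_sub, Polynomial.eval_one, Polynomial.eval_mul,
    Polynomial.eval_C, Polynomial.eval_X, zpow_natCast, ← Finset.prod_pow,
    ← Finset.prod_mul_distrib, ← mul_pow]
  exact Finset.prod_congr rfl fun i _ => by rw [div_mul_cancel₀ _ (den_ne_zero _ t)]

lemma conj_num_mul {d : ℕ} (lam : Fin d → 𝔻) (n : ℕ) (t : Torus) :
    conj ((numPoly lam n).eval (pt t)) * pt t ^ (n * d) = (denPoly lam n).eval (pt t) := by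
  simp only [denPoly, numPoly, Polynomial.eval_prod,
    Polynomial.eval_pow, Polynomial.eval_sub, Polynomial.eval_one, Polynomial.eval_mul,
    Polynomial.eval_C, Polynomial.eval_X, map_prod, map_pow, pow_mul]
  have : (pt t ^ n) ^ d = ∏ _i : Fin d, pt t ^ n := by simp
  rw [this, ← Finset.prod_mul_distrib]
  exact Finset.prod_congr rfl fun i _ => by rw [← mul_pow, conj_num]

lemma continuous_eval (P : Polynomial ℂ) : Continuous fun t : Torus => P.eval (pt t) :=
  P.continuous.comp continuous_pt

lemma memLp_top_of_continuous {g : Torus → ℂ} (hg : Continuous g) : MemLp g ∞ arc :=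
  (ContinuousMap.memLp (p := ∞) arc ℂ (⟨g, hg⟩ : C(Torus, ℂ)))

/-- Multiplication of an `L²` function by a polynomial in `e^{it}`. -/
def polyMul (P : Polynomial ℂ) (f : L2) : L2 :=
  (memLp_mul f (memLp_top_of_continuous (continuous_eval P))).toLp _

lemma polyMul_ae (P : Polynomial ℂ) (f : L2) :
    polyMul P f =ᵐ[arc] fun t => f t * P.eval (pt t) := MemLp.coeFn_toLp _

lemma fourierCoeff_polyMul (P : Polynomial ℂ) (f : L2) (k : ℤ) :
    fourierCoeff (polyMul P f) k = ∑ j ∈ P.support, P.coeff j * fourierCoeff f (k - j) := by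
  have hint : Integrable f arc := (Lp.memLp f).integrable (by norm_num)
  have e : ∀ᵐ t ∂arc, fourier (-k) t • polyMul P f t
      = ∑ j ∈ P.support, P.coeff j * (fourier (-(k - j)) t • f t) := by
    filter_upwards [polyMul_ae P f] with t ht
    rw [ht, Polynomial.eval_eq_sum, Polynomial.sum, Finset.mul_sum, Finset.smul_sum]
    refine Finset.sum_congr rfl fun j _ => ?_
    have : pt t ^ (-(k - (j : ℤ))) = pt t ^ (-k) * pt t ^ j := by
      rw [← zpow_natCast, ← zpow_add₀ (pt_ne_zero t)]; congr 1; ring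
    simp only [fourier_eq_zpow, smul_eq_mul, this]
    ring
  rw [fourierCoeff, integral_congr_ae e, integral_finsetSum]
  · refine Finset.sum_congr rfl fun j _ => ?_
    rw [integral_const_mul]; rfl
  · intro j _
    exact (hint.fourier_smul _).const_mul _

lemma polyMul_mem_hardy (P : Polynomial ℂ) {f : L2} (hf : f ∈ hardy) : polyMul P f ∈ hardy := by
  intro k hk
  rw [fourierCoeff_polyMul]
  refine Finset.sum_eq_zero fun j _ => ?_
  rw [hf _ (by omega), mul_zero]

lemma fourierLp_mem_hardy (j : ℕ) : (fourierLp 2 (j : ℤ) : L2) ∈ hardy := by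
  intro k hk
  rw [fourierCoeff_eq_repr, HilbertBasis.repr_apply_apply, coe_fourierBasis]
  exact orthonormal_fourier.2 (by omega)

/-- The functions `e^{ikt} / q(e^{it})`, where `q` is the denominator of `Bⁿ`. -/
def modelGen {d : ℕ} (lam : Fin d → 𝔻) (n : ℕ) (k : ℕ) : C(Torus, ℂ) where
  toFun t := pt t ^ k / (denPoly lam n).eval (pt t)
  continuous_toFun := (continuous_pt.pow k).div (continuous_eval _) (denPoly_ne_zero lam n)

lemma fourierCoeff_den_mul {d : ℕ} (lam : Fin d → 𝔻) (n : ℕ) {f : L2}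
    (hf : f ∈ blaschkeModel lam n) (k : ℤ) (hk : k < 0 ∨ (n * d : ℕ) ≤ k) :
    fourierCoeff (polyMul (denPoly lam n) f) k = 0 := by
  rcases hk with hk | hk
  · exact polyMul_mem_hardy _ hf.1 k hk
  obtain ⟨j, rfl⟩ : ∃ j : ℕ, k = (n * d : ℕ) + j := ⟨(k - (n * d : ℕ)).toNat, by omega⟩
  have hmem : polyMul (numPoly lam n) (fourierLp 2 (j : ℤ)) ∈ mulHardy (blaschkePow lam n) := by
    refine ⟨polyMul (denPoly lam n) (fourierLp 2 (j : ℤ)),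
      polyMul_mem_hardy _ (fourierLp_mem_hardy j), ?_⟩
    filter_upwards [polyMul_ae (numPoly lam n) (fourierLp 2 (j : ℤ)),
      polyMul_ae (denPoly lam n) (fourierLp 2 (j : ℤ))] with t h1 h2
    rw [h1, h2, ← blaschkePow_mul_den]; ring
  have h0 := (Submodule.mem_orthogonal _ _).1 hf.2 _ hmem
  rw [L2.inner_def] at h0
  rw [fourierCoeff, ← h0]
  refine integral_congr_ae ?_
  filter_upwards [polyMul_ae (numPoly lam n) (fourierLp 2 (j : ℤ)),
    polyMul_ae (denPoly lam n) f, coeFn_fourierLp (T := 2 * Real.pi) 2 (j : ℤ)] with t h1 h2 h3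
  rw [h1, h2, h3, RCLike.inner_apply, smul_eq_mul, ← conj_num_mul, fourier_eq_zpow,
    fourier_eq_zpow, map_mul, zpow_natCast, map_pow]
  have e1 : pt t ^ (-(((n * d : ℕ) : ℤ) + j)) * pt t ^ (n * d) * pt t ^ j = 1 := by
    rw [← zpow_natCast, ← zpow_natCast, ← zpow_add₀ (pt_ne_zero t), ← zpow_add₀ (pt_ne_zero t)]
    simp
  have e2 : conj (pt t) ^ j * pt t ^ j = 1 := by rw [← mul_pow, conj_pt, one_pow]
  have e3 : pt t ^ (-(((n * d : ℕ) : ℤ) + j)) * pt t ^ (n * d) = conj (pt t) ^ j :=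
    mul_right_cancel₀ (pow_ne_zero j (pt_ne_zero t)) (e1.trans e2.symm)
  rw [← e3]; ring

lemma blaschkeModel_le_span {d : ℕ} (lam : Fin d → 𝔻) (n : ℕ) :
    blaschkeModel lam n ≤ Submodule.span ℂ ((fun k : ℕ =>
      ContinuousMap.toLp 2 arc ℂ (modelGen lam n k)) '' (Finset.range (n * d) : Set ℕ)) := by
  intro f hf
  set g := polyMul (denPoly lam n) f with hg
  set s : Finset ℤ := (Finset.range (n * d)).map Nat.castEmbedding with hs
  have hsum : g = ∑ k ∈ Finset.range (n * d), fourierCoeff g (k : ℤ) • fourierLp 2 (k : ℤ) := by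
    have h1 := hasSum_fourier_series_L2 g
    have h2 : HasSum (fun i : ℤ => fourierCoeff g i • (fourierLp 2 i : L2))
        (∑ i ∈ s, fourierCoeff g i • fourierLp 2 i) := by
      refine hasSum_sum_of_ne_finset_zero fun k hk => ?_
      rw [hg, fourierCoeff_den_mul lam n hf k, zero_smul]
      by_contra! hcon
      apply hk
      simp only [hs, Finset.mem_map, Finset.mem_range, Nat.castEmbedding_apply]
      exact ⟨k.toNat, by omega, by omega⟩
    refine (h1.unique h2).trans ?_
    rw [hs, Finset.sum_map]
    rfl
  have hf' : f = ∑ k ∈ Finset.range (n * d), fourierCoeff g (k : ℤ) •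
      ContinuousMap.toLp 2 arc ℂ (modelGen lam n k) := by
    have e1 : ∑ k ∈ Finset.range (n * d), fourierCoeff g (k : ℤ) • (fourierLp 2 (k : ℤ) : L2)
        = ContinuousMap.toLp 2 arc ℂ
          (∑ k ∈ Finset.range (n * d), fourierCoeff g (k : ℤ) • fourier (k : ℤ)) := by
      simp [map_sum, map_smul]
    have e2 : ∑ k ∈ Finset.range (n * d), fourierCoeff g (k : ℤ) •
        ContinuousMap.toLp 2 arc ℂ (modelGen lam n k) = ContinuousMap.toLp 2 arc ℂ
          (∑ k ∈ Finset.range (n * d), fourierCoeff g (k : ℤ) • modelGen lam n k) := by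
      simp [map_sum, map_smul]
    rw [e1] at hsum
    rw [e2]
    apply Lp.ext
    have hg' : g =ᵐ[arc] (∑ k ∈ Finset.range (n * d), fourierCoeff g (k : ℤ) •
        (fourier (k : ℤ) : C(Torus, ℂ)) : C(Torus, ℂ)) := by
      nth_rw 1 [hsum]
      exact ContinuousMap.coeFn_toLp (p := 2) (𝕜 := ℂ) arc _
    filter_upwards [hg', polyMul_ae (denPoly lam n) f,
      ContinuousMap.coeFn_toLp (p := 2) (𝕜 := ℂ) arc
        (∑ k ∈ Finset.range (n * d), fourierCoeff g (k : ℤ) • modelGen lam n k)] with t h1 h2 h3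
    rw [h3]
    have hne := denPoly_ne_zero lam n t
    have h4 : f t = g t / (denPoly lam n).eval (pt t) := by
      rw [hg, h2, mul_div_cancel_right₀ _ hne]
    rw [h4, h1]
    simp only [ContinuousMap.coe_sum, Finset.sum_apply, ContinuousMap.coe_smul, Pi.smul_apply,
      Finset.sum_div, smul_eq_mul, fourier_eq_zpow, zpow_natCast, modelGen, ContinuousMap.coe_mk,
      mul_div_assoc]
  rw [hf']
  exact Submodule.sum_mem _ fun k hk => Submodule.smul_mem _ _
    (Submodule.subset_span ⟨k, by simpa using hk, rfl⟩)

instance instFiniteDimensionalBlaschkeModel {d : ℕ} (lam : Fin d → 𝔻) (n : ℕ) :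
    FiniteDimensional ℂ (blaschkeModel lam n) := by
  have : FiniteDimensional ℂ (Submodule.span ℂ ((fun k : ℕ =>
      ContinuousMap.toLp 2 arc ℂ (modelGen lam n k)) '' (Finset.range (n * d) : Set ℕ))) :=
    FiniteDimensional.span_of_finite ℂ (((Finset.range (n * d)).finite_toSet).image _)
  exact Submodule.finiteDimensional_of_le (blaschkeModel_le_span lam n)

lemma blaschkeModel_le_hardyInf {d : ℕ} (lam : Fin d → 𝔻) (n : ℕ) :
    blaschkeModel lam n ≤ hardyInf := by
  intro f hf
  refine ⟨hf.1, ?_⟩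
  refine Submodule.span_induction (p := fun (h : L2) _ => MemLp h ∞ arc) ?_ ?_ ?_ ?_
    (blaschkeModel_le_span lam n hf)
  · rintro _ ⟨k, _, rfl⟩
    exact (memLp_top_of_continuous (modelGen lam n k).continuous).ae_eq
      (ContinuousMap.coeFn_toLp (p := 2) (𝕜 := ℂ) arc _).symm
  · exact (MemLp.zero' (ε := ℂ)).ae_eq (Lp.coeFn_zero ℂ 2 arc).symm
  · intro f g _ _ hf hg
    exact (hf.add hg).ae_eq (Lp.coeFn_add f g).symm
  · intro c f _ hf
    exact (hf.const_smul c).ae_eq (Lp.coeFn_smul c f).symm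

/-! ### Distribution of eigenvalues and singular values -/

/-- The operator `T_{ϕ, K_{Bⁿ}}`. -/
def blaschkeCompression {d : ℕ} (lam : Fin d → 𝔻) (ϕ : L2) (n : ℕ) :
    blaschkeModel lam n →ₗ[ℂ] blaschkeModel lam n :=
  compression ϕ (blaschkeModel lam n) (blaschkeModel_le_hardyInf lam n)

/-- `T_ϕ` is distributed as `g` in the sense of the eigenvalues relative to `(K_{Bⁿ})ₙ`: for every
continuous compactly supported `G`, the mean of `G` over the eigenvalues of `T_{ϕ, K_{Bⁿ}}`
(repeated according to algebraic multiplicity) tends to `(1/2π) ∫_𝕋 G(g(ξ)) dξ`. -/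
def EigenDistributed {d : ℕ} (lam : Fin d → 𝔻) (ϕ : L2) (g : Torus → ℂ) : Prop :=
  ∀ G : ℂ → ℂ, Continuous G → HasCompactSupport G →
    Tendsto
      (fun n : ℕ => ((Module.finrank ℂ (blaschkeModel lam n) : ℂ))⁻¹ *
        ((blaschkeCompression lam ϕ n).charpoly.roots.map G).sum)
      atTop (𝓝 (∫ t, G (g t) ∂arc))

/-- `T_ϕ` is distributed as `g` in the sense of the singular values relative to `(K_{Bⁿ})ₙ`: for
every continuous compactly supported `G`, the mean of `G` over the `dim K_{Bⁿ}` singular values of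
`T_{ϕ, K_{Bⁿ}}` tends to `(1/2π) ∫_𝕋 G(g(ξ)) dξ`. -/
def SingularDistributed {d : ℕ} (lam : Fin d → 𝔻) (ϕ : L2) (g : Torus → ℝ) : Prop :=
  ∀ G : ℝ → ℂ, Continuous G → HasCompactSupport G →
    Tendsto
      (fun n : ℕ => ((Module.finrank ℂ (blaschkeModel lam n) : ℂ))⁻¹ *
        ∑ k ∈ Finset.range (Module.finrank ℂ (blaschkeModel lam n)),
          G ((blaschkeCompression lam ϕ n).singularValues k))
      atTop (𝓝 (∫ t, G (g t) ∂arc))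

end SzegoModel

end

open SzegoModel

/-
Let `B` be the Blaschke product and `e` an orthonormal basis of `K_B`. The functions `Bʲ eᵢ`,
`0 ≤ j < n`, form an orthonormal basis of `K_{Bⁿ}`, in which the compression of `T_ϕ` has the
Toeplitz entries `a_{j - k}`, once for every `i`: it is a direct sum of `dim K_B` copies of the
`n × n` Toeplitz matrix with symbol `φ`. For every finite `s`, the block circulant with symbol
`∑ m ∈ s, a_m zᵐ` is normal, its eigenvalues are the values of that polynomial at the `n`-th roots
of unity, and its squared Hilbert–Schmidt distance to the compression is at most
`dim K_B * (n * ∑ m ∉ s, |a_m|² + O(1))`. An inequality of Hoffman–Wielandt type turns this into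
closeness of eigenvalues and singular values, and Riemann sums give the integral as `n → ∞` and
then `s → ℤ`.

The powers of `B` are in general not orthogonal, but multiplication by a normalised element of
`K_B` without zeros on the circle is an automorphism of `L²(𝕋)` that makes them orthonormal; hence
the coefficients of a series `∑ a_n Bⁿ` are unique and square summable.
-/

namespace SzegoModel

section Coupling

variable {X V : Type*} [PseudoMetricSpace X] [NormedAddCommGroup V]

lemma exists_modulus_of_hasCompactSupport {G : X → V} (hG : Continuous G)
    (hc : HasCompactSupport G) {ε : ℝ} (hε : 0 < ε) :
    ∃ C : ℝ, 0 ≤ C ∧ ∀ x y, ‖G x - G y‖ ≤ ε + C * dist x y ^ 2 := by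
  obtain ⟨M, hM⟩ := hc.exists_bound_of_continuous hG
  obtain ⟨δ, hδ, hnear⟩ :=
    Metric.uniformContinuous_iff.1 (hc.uniformContinuous_of_continuous hG) ε hε
  refine ⟨2 * |M| / δ ^ 2, by positivity, fun x y => ?_⟩
  rcases lt_or_ge (dist x y) δ with hxy | hxy
  · have hclose : ‖G x - G y‖ < ε := by simpa only [dist_eq_norm] using hnear hxy
    have : 0 ≤ 2 * |M| / δ ^ 2 * dist x y ^ 2 := by positivity
    linarith
  · have hfar : 2 * |M| ≤ 2 * |M| / δ ^ 2 * dist x y ^ 2 := by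
      rw [div_mul_eq_mul_div, le_div_iff₀ (by positivity)]
      gcongr
    linarith [norm_sub_le (G x) (G y), hM x, hM y, le_abs_self M]

variable {ι κ : Type*} [Fintype ι] [Fintype κ] [NormedSpace ℝ V]

lemma norm_sum_sub_sum_le_of_coupling {w : ι → κ → ℝ} (hw : ∀ i j, 0 ≤ w i j)
    (hrow : ∀ i, ∑ j, w i j = 1) (hcol : ∀ j, ∑ i, w i j = 1) (f : ι → V) (g : κ → V) :
    ‖∑ i, f i - ∑ j, g j‖ ≤ ∑ i, ∑ j, w i j * ‖f i - g j‖ := by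
  have hf : ∑ i, f i = ∑ i, ∑ j, w i j • f i := by simp [← Finset.sum_smul, hrow]
  have hg : ∑ j, g j = ∑ i, ∑ j, w i j • g j := by
    rw [Finset.sum_comm]
    simp [← Finset.sum_smul, hcol]
  simp_rw [hf, hg, ← Finset.sum_sub_distrib, ← smul_sub]
  refine norm_sum_le_of_le _ fun i _ => norm_sum_le_of_le _ fun j _ => ?_
  rw [norm_smul, Real.norm_of_nonneg (hw i j)]

lemma norm_sum_sub_sum_le_of_modulus {w : ι → κ → ℝ} (hw : ∀ i j, 0 ≤ w i j)
    (hrow : ∀ i, ∑ j, w i j = 1) (hcol : ∀ j, ∑ i, w i j = 1) {G : X → V} {ε C : ℝ}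
    (hG : ∀ x y, ‖G x - G y‖ ≤ ε + C * dist x y ^ 2) (α : ι → X) (β : κ → X) :
    ‖∑ i, G (α i) - ∑ j, G (β j)‖ ≤
      ε * Fintype.card ι + C * ∑ i, ∑ j, w i j * dist (α i) (β j) ^ 2 :=
  calc ‖∑ i, G (α i) - ∑ j, G (β j)‖ ≤ ∑ i, ∑ j, w i j * ‖G (α i) - G (β j)‖ :=
        norm_sum_sub_sum_le_of_coupling hw hrow hcol _ _
    _ ≤ ∑ i, ∑ j, (ε * w i j + C * (w i j * dist (α i) (β j) ^ 2)) := by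
        gcongr with i _ j _
        nlinarith [mul_le_mul_of_nonneg_left (hG (α i) (β j)) (hw i j)]
    _ = ε * Fintype.card ι + C * ∑ i, ∑ j, w i j * dist (α i) (β j) ^ 2 := by
        simp [Finset.sum_add_distrib, ← Finset.mul_sum, hrow, mul_comm]

end Coupling

section HilbertSchmidt

variable {𝕜 E ι κ : Type*} [RCLike 𝕜] [NormedAddCommGroup E] [InnerProductSpace 𝕜 E]
  [Fintype ι] [Fintype κ]

lemma norm_sum_sub_sum_le_of_orthonormalBasis {X V : Type*} [PseudoMetricSpace X]
    [NormedAddCommGroup V] [NormedSpace ℝ V] (u : OrthonormalBasis ι 𝕜 E)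
    (v : OrthonormalBasis κ 𝕜 E) {G : X → V} {ε C R : ℝ} (hC : 0 ≤ C)
    (hG : ∀ x y, ‖G x - G y‖ ≤ ε + C * dist x y ^ 2) {α : ι → X} {β : κ → X}
    (hR : ∑ i, ∑ j, ‖⟪u i, v j⟫_𝕜‖ ^ 2 * dist (α i) (β j) ^ 2 ≤ R) :
    ‖∑ i, G (α i) - ∑ j, G (β j)‖ ≤ ε * Fintype.card ι + C * R := by
  refine (norm_sum_sub_sum_le_of_modulus (w := fun i j => ‖⟪u i, v j⟫_𝕜‖ ^ 2)
    (fun _ _ => by positivity) (fun i => ?_) (fun j => ?_) hG α β).trans (by gcongr)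
  · simp [v.sum_sq_norm_inner_left]
  · simp [u.sum_sq_norm_inner_right]

lemma sum_sq_norm_inner_le_of_pairwise_orthogonal {y : ι → E}
    (hy : Pairwise fun i k => ⟪y i, y k⟫_𝕜 = 0) (hnorm : ∀ i, y i ≠ 0 → ‖y i‖ = 1)
    (z : E) : ∑ i, ‖⟪y i, z⟫_𝕜‖ ^ 2 ≤ ‖z‖ ^ 2 := by
  classical
  have hon : Orthonormal 𝕜 fun i : {i // y i ≠ 0} => y i :=
    ⟨fun i => hnorm i i.2, fun i k hik => hy fun h => hik (Subtype.ext h)⟩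
  calc ∑ i, ‖⟪y i, z⟫_𝕜‖ ^ 2
      = ∑ i with y i ≠ 0, ‖⟪y i, z⟫_𝕜‖ ^ 2 := by
        rw [Finset.sum_filter_of_ne]
        intro i _ h hi
        simp [hi] at h
    _ = ∑ i : {i // y i ≠ 0}, ‖⟪y i, z⟫_𝕜‖ ^ 2 := Finset.sum_subtype _ (by simp) _
    _ ≤ ‖z‖ ^ 2 := hon.sum_inner_products_le z

lemma sum_sq_norm_inner_mul_dist_eq_of_isSymmetric (u : OrthonormalBasis ι 𝕜 E)
    (v : OrthonormalBasis κ 𝕜 E) {T S : E →ₗ[𝕜] E} (hT : T.IsSymmetric) {α : ι → ℝ} {β : κ → 𝕜}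
    (hu : ∀ i, T (u i) = (α i : 𝕜) • u i) (hv : ∀ j, S (v j) = β j • v j) :
    ∑ i, ∑ j, ‖⟪u i, v j⟫_𝕜‖ ^ 2 * dist (α i : 𝕜) (β j) ^ 2 = ∑ j, ‖(T - S) (v j)‖ ^ 2 := by
  rw [Finset.sum_comm]
  refine Finset.sum_congr rfl fun j _ => ?_
  rw [← u.sum_sq_norm_inner_right]
  refine Finset.sum_congr rfl fun i _ => ?_
  have : ⟪u i, (T - S) (v j)⟫_𝕜 = ((α i : 𝕜) - β j) * ⟪u i, v j⟫_𝕜 := by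
    rw [LinearMap.sub_apply, inner_sub_right, ← hT, hu, hv, inner_smul_left, inner_smul_right,
      RCLike.conj_ofReal, sub_mul]
  rw [this, norm_mul, mul_pow, dist_eq_norm, mul_comm]

variable [FiniteDimensional 𝕜 E]

lemma sum_sq_norm_apply_eq_adjoint (u : OrthonormalBasis ι 𝕜 E) (v : OrthonormalBasis κ 𝕜 E)
    (T : E →ₗ[𝕜] E) : ∑ i, ‖T (u i)‖ ^ 2 = ∑ j, ‖T.adjoint (v j)‖ ^ 2 :=
  calc ∑ i, ‖T (u i)‖ ^ 2 = ∑ i, ∑ j, ‖⟪v j, T (u i)⟫_𝕜‖ ^ 2 := by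
        simp_rw [v.sum_sq_norm_inner_right]
    _ = ∑ j, ∑ i, ‖⟪T.adjoint (v j), u i⟫_𝕜‖ ^ 2 := by
        simp_rw [LinearMap.adjoint_inner_left]
        exact Finset.sum_comm
    _ = ∑ j, ‖T.adjoint (v j)‖ ^ 2 := by simp_rw [u.sum_sq_norm_inner_left]

/-- The square of the Hilbert–Schmidt norm of an operator on a finite dimensional inner product
space, computed in the standard orthonormal basis; it controls how far apart the eigenvalues, or
the singular values, of two operators can be. -/
noncomputable def hilbertSchmidtSq (T : E →ₗ[𝕜] E) : ℝ :=
  ∑ i, ‖T (stdOrthonormalBasis 𝕜 E i)‖ ^ 2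

lemma sum_sq_norm_apply_eq_hilbertSchmidtSq (u : OrthonormalBasis ι 𝕜 E) (T : E →ₗ[𝕜] E) :
    ∑ i, ‖T (u i)‖ ^ 2 = hilbertSchmidtSq T :=
  (sum_sq_norm_apply_eq_adjoint u u T).trans (sum_sq_norm_apply_eq_adjoint _ u T).symm

lemma adjoint_apply_of_orthonormalBasis (v : OrthonormalBasis κ 𝕜 E) {S : E →ₗ[𝕜] E} {β : κ → 𝕜}
    (hv : ∀ j, S (v j) = β j • v j) (j : κ) : S.adjoint (v j) = conj (β j) • v j := by
  classical
  refine InnerProductSpace.ext_inner_left_basis v.toBasis fun k => ?_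
  rw [v.coe_toBasis, LinearMap.adjoint_inner_right, hv, inner_smul_left, inner_smul_right,
    orthonormal_iff_ite.1 v.orthonormal]
  split_ifs with h
  · rw [h]
  · simp

lemma exists_leftSingularVectors (u : OrthonormalBasis ι 𝕜 E) {T : E →ₗ[𝕜] E} {σ : ι → ℝ}
    (hu : ∀ i, T.adjoint (T (u i)) = (σ i : 𝕜) ^ 2 • u i) :
    ∃ y : ι → E, (∀ i, T (u i) = (σ i : 𝕜) • y i) ∧ (∀ i, T.adjoint (y i) = (σ i : 𝕜) • u i) ∧
      ∀ z, ∑ i, ‖⟪y i, z⟫_𝕜‖ ^ 2 ≤ ‖z‖ ^ 2 := by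
  classical
  have hinner : ∀ i k, ⟪T (u i), T (u k)⟫_𝕜 = if i = k then (σ i : 𝕜) ^ 2 else 0 := fun i k => by
    rw [← LinearMap.adjoint_inner_left, hu, inner_smul_left, ← RCLike.ofReal_pow,
      RCLike.conj_ofReal, orthonormal_iff_ite.1 u.orthonormal]
    simp
  have hnorm : ∀ i, ‖T (u i)‖ = |σ i| := fun i => by
    have h : ((‖T (u i)‖ ^ 2 : ℝ) : 𝕜) = ((σ i ^ 2 : ℝ) : 𝕜) := by
      rw [RCLike.ofReal_pow, ← inner_self_eq_norm_sq_to_K, hinner, if_pos rfl, RCLike.ofReal_pow]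
    rw [← abs_norm, ← sq_eq_sq_iff_abs_eq_abs]
    exact RCLike.ofReal_inj.1 h
  refine ⟨fun i => (σ i : 𝕜)⁻¹ • T (u i), fun i => ?_, fun i => ?_,
    sum_sq_norm_inner_le_of_pairwise_orthogonal (fun i k hik => ?_) fun i hi => ?_⟩
  · rcases eq_or_ne (σ i) 0 with h | h
    · have : T (u i) = 0 := norm_eq_zero.1 (by rw [hnorm, h, abs_zero])
      simp [this]
    · rw [smul_inv_smul₀ (by exact_mod_cast h)]
  · rw [map_smul, hu, smul_smul]
    congr 1
    rcases eq_or_ne (σ i : 𝕜) 0 with h | h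
    · simp [h]
    · field_simp
  · simp only [inner_smul_left, inner_smul_right, hinner, if_neg hik, mul_zero]
  · have h : σ i ≠ 0 := fun h => hi (by simp [h])
    rw [norm_smul, norm_inv, RCLike.norm_ofReal, hnorm, inv_mul_cancel₀ (abs_ne_zero.2 h)]

lemma sq_sub_norm_mul_sq_norm_le {σ : ℝ} (hσ : 0 ≤ σ) (β a b : 𝕜) :
    (σ - ‖β‖) ^ 2 * ‖a‖ ^ 2 ≤ ‖(σ : 𝕜) * a - β * b‖ ^ 2 + ‖(σ : 𝕜) * b - conj β * a‖ ^ 2 := by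
  have h₁ := sq_le_sq' (neg_le_of_abs_le (abs_norm_sub_norm_le ((σ : 𝕜) * a) (β * b)))
    (le_of_abs_le (abs_norm_sub_norm_le _ _))
  have h₂ := sq_le_sq' (neg_le_of_abs_le (abs_norm_sub_norm_le ((σ : 𝕜) * b) (conj β * a)))
    (le_of_abs_le (abs_norm_sub_norm_le _ _))
  simp only [norm_mul, RCLike.norm_ofReal, abs_of_nonneg hσ, RCLike.norm_conj] at h₁ h₂
  nlinarith [sq_nonneg ((σ - ‖β‖) * ‖b‖),
    mul_nonneg (mul_nonneg hσ (norm_nonneg β)) (sq_nonneg (‖a‖ - ‖b‖))]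

lemma sum_sq_norm_inner_mul_dist_le_of_adjoint_comp_self (u : OrthonormalBasis ι 𝕜 E)
    (v : OrthonormalBasis κ 𝕜 E) {T S : E →ₗ[𝕜] E} {σ : ι → ℝ} {β : κ → 𝕜} (hσ : ∀ i, 0 ≤ σ i)
    (hu : ∀ i, T.adjoint (T (u i)) = (σ i : 𝕜) ^ 2 • u i) (hv : ∀ j, S (v j) = β j • v j) :
    ∑ i, ∑ j, ‖⟪u i, v j⟫_𝕜‖ ^ 2 * dist (σ i) ‖β j‖ ^ 2 ≤ 2 * hilbertSchmidtSq (T - S) := by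
  obtain ⟨y, hTu, hTy, hbessel⟩ := exists_leftSingularVectors u hu
  have hy : ∀ i j, ⟪y i, (T - S) (v j)⟫_𝕜 = (σ i : 𝕜) * ⟪u i, v j⟫_𝕜 - β j * ⟪y i, v j⟫_𝕜 :=
    fun i j => by
      rw [LinearMap.sub_apply, inner_sub_right, ← LinearMap.adjoint_inner_left, hTy, hv,
        inner_smul_left, inner_smul_right, RCLike.conj_ofReal]
  have hu' : ∀ i j, ⟪(T - S) (u i), v j⟫_𝕜 =
      (σ i : 𝕜) * ⟪y i, v j⟫_𝕜 - conj (β j) * ⟪u i, v j⟫_𝕜 := fun i j => by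
    rw [LinearMap.sub_apply, inner_sub_left, ← LinearMap.adjoint_inner_right S,
      adjoint_apply_of_orthonormalBasis v hv, hTu, inner_smul_left, inner_smul_right,
      RCLike.conj_ofReal]
  calc ∑ i, ∑ j, ‖⟪u i, v j⟫_𝕜‖ ^ 2 * dist (σ i) ‖β j‖ ^ 2
      ≤ ∑ i, ∑ j, (‖⟪y i, (T - S) (v j)⟫_𝕜‖ ^ 2 + ‖⟪(T - S) (u i), v j⟫_𝕜‖ ^ 2) := by
        gcongr with i _ j _
        rw [hy, hu', Real.dist_eq, sq_abs, mul_comm]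
        exact sq_sub_norm_mul_sq_norm_le (hσ i) _ _ _
    _ = ∑ j, ∑ i, ‖⟪y i, (T - S) (v j)⟫_𝕜‖ ^ 2 + ∑ i, ‖(T - S) (u i)‖ ^ 2 := by
        simp_rw [Finset.sum_add_distrib, v.sum_sq_norm_inner_left]
        rw [Finset.sum_comm]
    _ ≤ ∑ j, ‖(T - S) (v j)‖ ^ 2 + ∑ i, ‖(T - S) (u i)‖ ^ 2 := by
        gcongr with j
        exact hbessel _
    _ = 2 * hilbertSchmidtSq (T - S) := by
        rw [sum_sq_norm_apply_eq_hilbertSchmidtSq, sum_sq_norm_apply_eq_hilbertSchmidtSq, two_mul]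

end HilbertSchmidt

section Circulant

/-- The trigonometric polynomial `∑_{m ∈ s} a_m z^m` on the circle, the symbol of the circulant
operators below. -/
noncomputable def trigPoly (a : ℤ → ℂ) (s : Finset ℤ) : C(Torus, ℂ) :=
  ∑ m ∈ s, a m • fourier m

lemma trigPoly_apply (a : ℤ → ℂ) (s : Finset ℤ) (t : Torus) :
    trigPoly a s t = ∑ m ∈ s, a m * fourier m t := by
  simp [trigPoly, ContinuousMap.sum_apply]

lemma toLp_trigPoly (a : ℤ → ℂ) (s : Finset ℤ) :
    ContinuousMap.toLp 2 arc ℂ (trigPoly a s) = ∑ m ∈ s, a m • (fourierLp 2 m : L2) := by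
  simp [trigPoly, map_sum, map_smul]

/-- The `n`-th root of unity `e^{2πik/n}`, as a point of the torus (the point `1` if `n = 0`). -/
noncomputable def rootPt (n k : ℕ) : Torus :=
  ((2 * Real.pi * (k / n) : ℝ) : Torus)

variable {n : ℕ} [NeZero n]

lemma fourier_rootPt (m : ℤ) (k : ZMod n) :
    fourier m (rootPt n k.val) = ZMod.stdAddChar ((m : ZMod n) * k) := by
  have hmk : (m : ZMod n) * k = ((m * k.val : ℤ) : ZMod n) := by simp
  have hpi : (Real.pi : ℂ) ≠ 0 := by exact_mod_cast Real.pi_ne_zero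
  rw [hmk, ZMod.stdAddChar_coe, rootPt, fourier_coe_apply]
  congr 1
  push_cast
  field_simp

lemma sum_stdAddChar_mul (b : ZMod n) :
    ∑ j : ZMod n, ZMod.stdAddChar (j * b) = if b = 0 then (n : ℂ) else 0 := by
  rw [AddChar.sum_mulShift b (ZMod.isPrimitive_stdAddChar n), ZMod.card, Nat.cast_ite,
    Nat.cast_zero]

lemma conj_stdAddChar (b : ZMod n) :
    conj (ZMod.stdAddChar b : ℂ) = ZMod.stdAddChar (-b) := by
  rw [ZMod.stdAddChar_apply, ZMod.stdAddChar_apply, AddChar.map_neg_eq_inv, Circle.coe_inv_eq_conj]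

variable {E : Type*} [NormedAddCommGroup E] [InnerProductSpace ℂ E] {ι : Type*} [Fintype ι]

/-- The block circulant operator with symbol `∑_{m ∈ s} a_m z^m` in an orthonormal basis indexed
by `ℤ/n × ι`: it acts on the first index by cyclic shifts and leaves the second one alone. -/
noncomputable def circulant (x : OrthonormalBasis (ZMod n × ι) ℂ E) (a : ℤ → ℂ) (s : Finset ℤ) :
    E →ₗ[ℂ] E :=
  x.toBasis.constr ℂ fun p => ∑ m ∈ s, a m • x (p.1 + m, p.2)

lemma circulant_apply (x : OrthonormalBasis (ZMod n × ι) ℂ E) (a : ℤ → ℂ) (s : Finset ℤ)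
    (p : ZMod n × ι) : circulant x a s (x p) = ∑ m ∈ s, a m • x (p.1 + m, p.2) := by
  rw [circulant, ← x.coe_toBasis, Module.Basis.constr_basis]

/-- The vectors of the discrete Fourier transform, in the first index, of an orthonormal basis
indexed by `ℤ/n × ι`. -/
noncomputable def dftVec (x : OrthonormalBasis (ZMod n × ι) ℂ E) (p : ZMod n × ι) : E :=
  ((√n : ℝ) : ℂ)⁻¹ • ∑ j : ZMod n, (ZMod.stdAddChar (-(j * p.1)) : ℂ) • x (j, p.2)

lemma circulant_dftVec (x : OrthonormalBasis (ZMod n × ι) ℂ E) (a : ℤ → ℂ) (s : Finset ℤ)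
    (p : ZMod n × ι) :
    circulant x a s (dftVec x p) = trigPoly a s (rootPt n p.1.val) • dftVec x p := by
  simp only [dftVec, map_smul, map_sum, circulant_apply]
  rw [smul_comm]
  congr 1
  simp_rw [trigPoly_apply, Finset.sum_smul, Finset.smul_sum]
  rw [Finset.sum_comm]
  refine Finset.sum_congr rfl fun m _ => ?_
  rw [← Equiv.sum_comp (Equiv.addRight (m : ZMod n)) fun j =>
    (a m * fourier m (rootPt n p.1.val)) • (ZMod.stdAddChar (-(j * p.1)) : ℂ) • x (j, p.2)]
  refine Finset.sum_congr rfl fun j _ => ?_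
  rw [Equiv.coe_addRight, fourier_rootPt, smul_smul, smul_smul, mul_assoc,
    ← AddChar.map_add_eq_mul, mul_comm]
  congr 3
  ring

lemma orthonormal_dftVec (x : OrthonormalBasis (ZMod n × ι) ℂ E) : Orthonormal ℂ (dftVec x) := by
  classical
  have hn : (n : ℂ) ≠ 0 := by exact_mod_cast NeZero.ne n
  have hsq : ((√n : ℝ) : ℂ)⁻¹ * ((√n : ℝ) : ℂ)⁻¹ = (n : ℂ)⁻¹ := by
    rw [← mul_inv, ← Complex.ofReal_mul, Real.mul_self_sqrt (Nat.cast_nonneg n),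
      Complex.ofReal_natCast]
  rw [orthonormal_iff_ite]
  rintro ⟨k, i⟩ ⟨l, i'⟩
  simp only [dftVec, inner_smul_left, inner_smul_right, sum_inner, inner_sum,
    orthonormal_iff_ite.1 x.orthonormal, Prod.mk.injEq, map_inv₀, Complex.conj_ofReal]
  rcases eq_or_ne i i' with rfl | hi
  · have hchar : ∀ j : ZMod n, (ZMod.stdAddChar (-(j * l)) : ℂ) *
        (((√n : ℝ) : ℂ)⁻¹ * conj (ZMod.stdAddChar (-(j * k)) : ℂ))
        = ((√n : ℝ) : ℂ)⁻¹ * ZMod.stdAddChar (j * (k - l)) := fun j => by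
      rw [conj_stdAddChar, mul_left_comm, ← AddChar.map_add_eq_mul]
      congr 2
      ring
    simp only [and_true, mul_ite, mul_one, mul_zero, Finset.mem_univ, if_true,
      Finset.sum_ite_eq', hchar, ← Finset.mul_sum, sum_stdAddChar_mul, sub_eq_zero]
    rw [← mul_assoc, hsq, inv_mul_cancel₀ hn]
  · simp [hi]

/-- The orthonormal basis `dftVec x`, in which all block circulant operators are diagonal. -/
noncomputable def dftBasis (x : OrthonormalBasis (ZMod n × ι) ℂ E) :
    OrthonormalBasis (ZMod n × ι) ℂ E :=
  have := Module.Finite.of_basis x.toBasis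
  OrthonormalBasis.mk (orthonormal_dftVec x)
    ((orthonormal_dftVec x).linearIndependent.span_eq_top_of_card_eq_finrank'
      (Module.finrank_eq_card_basis x.toBasis).symm).ge

lemma circulant_dftBasis (x : OrthonormalBasis (ZMod n × ι) ℂ E) (a : ℤ → ℂ) (s : Finset ℤ)
    (p : ZMod n × ι) :
    circulant x a s (dftBasis x p) = trigPoly a s (rootPt n p.1.val) • dftBasis x p := by
  simp only [dftBasis, OrthonormalBasis.coe_mk, circulant_dftVec]

end Circulant

section BlockToeplitz

open scoped Finset

lemma norm_sq_sum_smul_fiber {𝕜 E ι κ : Type*} [RCLike 𝕜] [NormedAddCommGroup E]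
    [InnerProductSpace 𝕜 E] [Fintype ι] [Fintype κ] (x : OrthonormalBasis (κ × ι) 𝕜 E)
    (c : κ → 𝕜) (i : ι) : ‖∑ k, c k • x (k, i)‖ ^ 2 = ∑ k, ‖c k‖ ^ 2 :=
  (x.orthonormal.comp (fun k => (k, i))
    (Prod.mk_left_injective i)).orthogonalFamily.norm_sum c Finset.univ

variable {n : ℕ} [NeZero n]

lemma sum_zmod_val_sub_le_tsum {b : ℤ → ℝ} (hb : Summable b) (h0 : ∀ m, 0 ≤ b m) (j : ZMod n) :
    ∑ k : ZMod n, b ((k.val : ℤ) - j.val) ≤ ∑' m, b m := by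
  have hinj : Function.Injective fun k : ZMod n => (k.val : ℤ) - j.val :=
    fun k l h => ZMod.val_injective n (Int.ofNat_injective (sub_left_injective h))
  have := hb.sum_le_tsum (Finset.univ.map ⟨_, hinj⟩) fun m _ => h0 m
  rwa [Finset.sum_map] at this

variable {E : Type*} [NormedAddCommGroup E] [InnerProductSpace ℂ E] {ι : Type*} [Fintype ι]
  {x : OrthonormalBasis (ZMod n × ι) ℂ E} {a : ℤ → ℂ} {T : E →ₗ[ℂ] E}

/-- `T` is the block Toeplitz operator with matrix `(a_{k-j} δ_{il})` in the basis `x`. The indices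
`k, j : ℤ/n` are represented in `{0, …, n - 1}`, so that `k - j` is not reduced modulo `n`. -/
def IsBlockToeplitz (x : OrthonormalBasis (ZMod n × ι) ℂ E) (a : ℤ → ℂ) (T : E →ₗ[ℂ] E) : Prop :=
  ∀ p, T (x p) = ∑ k : ZMod n, a ((k.val : ℤ) - p.1.val) • x (k, p.2)

/-- The bound, uniform in `n`, for the part of the Hilbert–Schmidt distance between a block Toeplitz
operator and the block circulant operator with truncated symbol `∑_{m ∈ s} a_m z^m` that comes from
the columns which a shift by some `m ∈ s` wraps around: there are at most `∑_{m ∈ s} |m|` of them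
for each second index. -/
noncomputable def wrapBound (a : ℤ → ℂ) (s : Finset ℤ) : ℝ :=
  (∑ m ∈ s, m.natAbs : ℕ) * (2 * (∑' m, ‖a m‖ ^ 2 + (∑ m ∈ s, ‖a m‖) ^ 2))

lemma circulant_apply_of_forall_val_add_mem (x : OrthonormalBasis (ZMod n × ι) ℂ E) (a : ℤ → ℂ)
    (s : Finset ℤ) {p : ZMod n × ι} (hp : ∀ m ∈ s, (p.1.val + m : ℤ) ∈ Set.Ico 0 (n : ℤ)) :
    circulant x a s (x p) = ∑ k : ZMod n, if (k.val : ℤ) - p.1.val ∈ s then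
      a ((k.val : ℤ) - p.1.val) • x (k, p.2) else 0 := by
  have hval : ∀ m ∈ s, ((p.1 + m : ZMod n).val : ℤ) = p.1.val + m := fun m hm => by
    have hcast : (p.1 + m : ZMod n) = ((p.1.val + m : ℤ) : ZMod n) := by simp
    rw [hcast, ZMod.val_intCast, Int.emod_eq_of_lt (hp m hm).1 (hp m hm).2]
  rw [circulant_apply, ← Finset.sum_filter]
  refine Finset.sum_nbij' (fun m => p.1 + m) (fun k => (k.val : ℤ) - p.1.val) ?_ ?_ ?_ ?_ ?_
  · intro m hm
    rwa [Finset.mem_filter_univ, hval m hm, add_sub_cancel_left]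
  · intro k hk
    simpa using hk
  · intro m hm
    simp [hval m hm]
  · intro k _
    simp
  · intro m hm
    simp [hval m hm]

namespace IsBlockToeplitz

lemma norm_sq_sub_circulant_le_tsum (hT : IsBlockToeplitz x a T)
    (ha : Summable fun m => ‖a m‖ ^ 2) (s : Finset ℤ) {p : ZMod n × ι}
    (hp : ∀ m ∈ s, (p.1.val + m : ℤ) ∈ Set.Ico 0 (n : ℤ)) :
    ‖(T - circulant x a s) (x p)‖ ^ 2 ≤ ∑' m : {m // m ∉ s}, ‖a m‖ ^ 2 := by
  classical
  set b : ℤ → ℂ := fun m => if m ∈ s then 0 else a m with hb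
  have hcol : (T - circulant x a s) (x p) =
      ∑ k : ZMod n, b ((k.val : ℤ) - p.1.val) • x (k, p.2) := by
    rw [LinearMap.sub_apply, hT, circulant_apply_of_forall_val_add_mem x a s hp,
      ← Finset.sum_sub_distrib]
    refine Finset.sum_congr rfl fun k _ => ?_
    simp only [hb]
    split_ifs <;> simp
  have hind : (fun m => ‖b m‖ ^ 2) = {m | m ∉ s}.indicator fun m => ‖a m‖ ^ 2 := by
    ext m
    by_cases hm : m ∈ s <;> simp [hb, hm]
  calc ‖(T - circulant x a s) (x p)‖ ^ 2 = ∑ k : ZMod n, ‖b ((k.val : ℤ) - p.1.val)‖ ^ 2 := by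
        rw [hcol, norm_sq_sum_smul_fiber]
    _ ≤ ∑' m, ‖b m‖ ^ 2 := sum_zmod_val_sub_le_tsum (b := fun m => ‖b m‖ ^ 2)
        (hind ▸ ha.indicator _) (fun _ => by positivity) _
    _ = ∑' m : {m // m ∉ s}, ‖a m‖ ^ 2 := by
        rw [hind]
        exact (tsum_subtype {m | m ∉ s} _).symm

lemma norm_sq_sub_circulant_le (hT : IsBlockToeplitz x a T) (ha : Summable fun m => ‖a m‖ ^ 2)
    (s : Finset ℤ) (p : ZMod n × ι) : ‖(T - circulant x a s) (x p)‖ ^ 2 ≤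
      2 * (∑' m, ‖a m‖ ^ 2 + (∑ m ∈ s, ‖a m‖) ^ 2) := by
  have hToeplitz : ‖T (x p)‖ ^ 2 ≤ ∑' m, ‖a m‖ ^ 2 := by
    rw [hT, norm_sq_sum_smul_fiber]
    exact sum_zmod_val_sub_le_tsum ha (fun _ => by positivity) _
  have hcirculant : ‖circulant x a s (x p)‖ ≤ ∑ m ∈ s, ‖a m‖ := by
    rw [circulant_apply]
    refine norm_sum_le_of_le _ fun m _ => ?_
    rw [norm_smul, x.norm_eq_one, mul_one]
  calc ‖(T - circulant x a s) (x p)‖ ^ 2 ≤ (‖T (x p)‖ + ‖circulant x a s (x p)‖) ^ 2 := by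
        gcongr
        exact norm_sub_le _ _
    _ ≤ 2 * (‖T (x p)‖ ^ 2 + ‖circulant x a s (x p)‖ ^ 2) := add_sq_le
    _ ≤ 2 * (∑' m, ‖a m‖ ^ 2 + (∑ m ∈ s, ‖a m‖) ^ 2) := by gcongr

end IsBlockToeplitz

lemma card_val_add_notMem_Ico_le (m : ℤ) :
    #{j : ZMod n | (j.val + m : ℤ) ∉ Set.Ico 0 (n : ℤ)} ≤ m.natAbs := by
  rcases le_or_gt 0 m with hm | hm
  · refine (Finset.card_le_card_of_injOn (t := Finset.Ico (n - m.natAbs) n) ZMod.val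
      (fun j hj => ?_) (ZMod.val_injective n).injOn).trans (by rw [Nat.card_Ico]; omega)
    have := ZMod.val_lt j
    simp only [Finset.coe_filter, Set.mem_Ico, Finset.mem_univ, true_and, Set.mem_ofPred_eq] at hj
    simp only [Finset.coe_Ico, Set.mem_Ico]
    omega
  · refine (Finset.card_le_card_of_injOn (t := Finset.range m.natAbs) ZMod.val
      (fun j hj => ?_) (ZMod.val_injective n).injOn).trans_eq (Finset.card_range _)
    have := ZMod.val_lt j
    simp only [Finset.coe_filter, Set.mem_Ico, Finset.mem_univ, true_and, Set.mem_ofPred_eq] at hj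
    simp only [Finset.coe_range, Set.mem_Iio]
    omega

lemma card_exists_val_add_notMem_Ico_le (s : Finset ℤ) :
    #{j : ZMod n | ∃ m ∈ s, (j.val + m : ℤ) ∉ Set.Ico 0 (n : ℤ)} ≤ ∑ m ∈ s, m.natAbs := by
  classical
  have hunion : ({j : ZMod n | ∃ m ∈ s, (j.val + m : ℤ) ∉ Set.Ico 0 (n : ℤ)} : Finset (ZMod n)) =
      s.biUnion fun m => {j | (j.val + m : ℤ) ∉ Set.Ico 0 (n : ℤ)} := by
    ext j
    simp
  rw [hunion]
  exact Finset.card_biUnion_le.trans (Finset.sum_le_sum fun m _ => card_val_add_notMem_Ico_le m)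

lemma IsBlockToeplitz.hilbertSchmidtSq_sub_circulant_le [FiniteDimensional ℂ E]
    (hT : IsBlockToeplitz x a T) (ha : Summable fun m => ‖a m‖ ^ 2) (s : Finset ℤ) :
    hilbertSchmidtSq (T - circulant x a s) ≤
      Fintype.card ι * (n * ∑' m : {m // m ∉ s}, ‖a m‖ ^ 2 + wrapBound a s) := by
  set η := ∑' m : {m // m ∉ s}, ‖a m‖ ^ 2
  set R := 2 * (∑' m, ‖a m‖ ^ 2 + (∑ m ∈ s, ‖a m‖) ^ 2)
  set wraps : ZMod n → Prop := fun j => ∃ m ∈ s, (j.val + m : ℤ) ∉ Set.Ico 0 (n : ℤ)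
  have hη : 0 ≤ η := tsum_nonneg fun m => by positivity
  have hR : 0 ≤ R := by
    have : 0 ≤ ∑' m, ‖a m‖ ^ 2 := tsum_nonneg fun m => by positivity
    positivity
  set colBound : ZMod n → ℝ := fun j => η + if wraps j then R else 0 with hcolBound
  have hcol : ∀ p : ZMod n × ι, ‖(T - circulant x a s) (x p)‖ ^ 2 ≤ colBound p.1 := fun p => by
    rw [hcolBound]
    dsimp only
    split_ifs with hp
    · linarith [hT.norm_sq_sub_circulant_le ha s p]
    · rw [add_zero]
      exact hT.norm_sq_sub_circulant_le_tsum ha s fun m hm => by_contra fun h => hp ⟨m, hm, h⟩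
  have hcard : (#{j | wraps j} : ℝ) ≤ (∑ m ∈ s, m.natAbs : ℕ) :=
    mod_cast card_exists_val_add_notMem_Ico_le s
  have hwrap : #{j | wraps j} * R ≤ wrapBound a s := mul_le_mul_of_nonneg_right hcard hR
  calc hilbertSchmidtSq (T - circulant x a s)
      = ∑ p, ‖(T - circulant x a s) (x p)‖ ^ 2 :=
        (sum_sq_norm_apply_eq_hilbertSchmidtSq x _).symm
    _ ≤ ∑ p : ZMod n × ι, colBound p.1 := Finset.sum_le_sum fun p _ => hcol p
    _ = Fintype.card ι * ∑ j, colBound j := by simp [Fintype.sum_prod_type_right]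
    _ = Fintype.card ι * (n * η + #{j | wraps j} * R) := by
        simp [hcolBound, Finset.sum_add_distrib, ← Finset.sum_filter]
    _ ≤ Fintype.card ι * (n * η + wrapBound a s) := by gcongr

end BlockToeplitz

section CompositionIntegral

variable {Ω E V : Type*} {mΩ : MeasurableSpace Ω} {μ : Measure Ω} [NormedAddCommGroup E]
  [NormedAddCommGroup V] [NormedSpace ℝ V]

lemma integral_norm_sq_eq_norm_sq (f : Lp E 2 μ) : ∫ t, ‖f t‖ ^ 2 ∂μ = ‖f‖ ^ 2 := by
  have hnonneg : 0 ≤ ∫ t, ‖f t‖ ^ 2 ∂μ := integral_nonneg fun t => by positivity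
  rw [Lp.norm_def, (Lp.memLp f).eLpNorm_eq_integral_rpow_norm two_ne_zero ENNReal.ofNat_ne_top,
    ENNReal.toReal_ofReal (by positivity)]
  simp only [ENNReal.toReal_ofNat, Real.rpow_ofNat]
  exact (Real.rpow_inv_natCast_pow hnonneg two_ne_zero).symm

lemma norm_integral_comp_sub_le [IsProbabilityMeasure μ] {G : E → V} (hG : Continuous G)
    (hc : HasCompactSupport G) {ε C : ℝ} (hmod : ∀ x y, ‖G x - G y‖ ≤ ε + C * dist x y ^ 2)
    (f g : Lp E 2 μ) :
    ‖∫ t, G (f t) ∂μ - ∫ t, G (g t) ∂μ‖ ≤ ε + C * dist f g ^ 2 := by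
  obtain ⟨B, hB⟩ := hc.exists_bound_of_continuous hG
  have hint : ∀ f : Lp E 2 μ, Integrable (fun t => G (f t)) μ := fun f =>
    .of_bound (hG.comp_aestronglyMeasurable (Lp.aestronglyMeasurable f)) B
      (.of_forall fun t => hB _)
  have hsq : Integrable (fun t => ‖(f - g) t‖ ^ 2) μ :=
    (Lp.memLp (f - g)).integrable_norm_pow two_ne_zero
  rw [← integral_sub (hint f) (hint g)]
  calc ‖∫ t, (G (f t) - G (g t)) ∂μ‖ ≤ ∫ t, (ε + C * ‖(f - g) t‖ ^ 2) ∂μ := by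
        refine norm_integral_le_of_norm_le ((integrable_const _).add (hsq.const_mul _)) ?_
        filter_upwards [Lp.coeFn_sub f g] with t ht
        rw [ht, Pi.sub_apply, ← dist_eq_norm (f t)]
        exact hmod _ _
    _ = ε + C * dist f g ^ 2 := by
        rw [integral_add (integrable_const _) (hsq.const_mul _), integral_const_mul,
          integral_norm_sq_eq_norm_sq, dist_eq_norm]
        simp

lemma continuous_integral_comp_of_hasCompactSupport [IsProbabilityMeasure μ] {G : E → V}
    (hG : Continuous G) (hc : HasCompactSupport G) :
    Continuous fun f : Lp E 2 μ => ∫ t, G (f t) ∂μ := by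
  refine continuous_iff_continuousAt.2 fun f => Metric.tendsto_nhds.2 fun δ hδ => ?_
  obtain ⟨C, -, hmod⟩ := exists_modulus_of_hasCompactSupport hG hc (half_pos hδ)
  have hlim : Tendsto (fun g => δ / 2 + C * dist g f ^ 2) (𝓝 f) (𝓝 (δ / 2 + C * dist f f ^ 2)) :=
    Continuous.tendsto (by fun_prop) f
  filter_upwards [hlim.eventually_lt_const (u := δ) (by simpa using half_lt_self hδ)] with g hg
  rw [dist_eq_norm]
  exact (norm_integral_comp_sub_le hG hc hmod g f).trans_lt hg

end CompositionIntegral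

section RootAverages

lemma sum_zmod_val {M : Type*} [AddCommMonoid M] (n : ℕ) [NeZero n] (g : ℕ → M) :
    ∑ k : ZMod n, g k.val = ∑ k ∈ Finset.range n, g k := by
  obtain _ | n := n
  · exact absurd rfl (NeZero.ne 0)
  · exact Fin.sum_univ_eq_sum_range g (n + 1)

/-- The mean of `f` over the `n`-th roots of unity. -/
noncomputable def rootAvg (n : ℕ) (f : Torus → ℂ) : ℂ :=
  (n : ℂ)⁻¹ * ∑ k ∈ Finset.range n, f (rootPt n k)

lemma lipschitzWith_rootAvg (n : ℕ) : LipschitzWith 1 fun f : C(Torus, ℂ) => rootAvg n f := by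
  refine LipschitzWith.of_dist_le_mul fun f g => ?_
  rw [NNReal.coe_one, one_mul, dist_eq_norm, rootAvg, rootAvg, ← mul_sub, ← Finset.sum_sub_distrib,
    norm_mul, norm_inv, Complex.norm_natCast]
  calc (n : ℝ)⁻¹ * ‖∑ k ∈ Finset.range n, (f (rootPt n k) - g (rootPt n k))‖
      ≤ (n : ℝ)⁻¹ * (n * dist f g) := by
        gcongr
        rw [← nsmul_eq_mul, ← Finset.card_range n, ← Finset.sum_const, Finset.card_range]
        refine norm_sum_le_of_le _ fun k _ => ?_
        exact (dist_eq_norm (f (rootPt n k)) _).symm.trans_le (f.dist_apply_le_dist _)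
    _ ≤ dist f g := by
        rw [← mul_assoc]
        exact mul_le_of_le_one_left dist_nonneg inv_mul_le_one

lemma integral_fourier (m : ℤ) : ∫ t, fourier m t ∂arc = if m = 0 then 1 else 0 := by
  have := congrFun (fourierCoeff_fourier (T := 2 * Real.pi) m) 0
  rw [fourierCoeff] at this
  simpa [Pi.single_apply, eq_comm] using this

lemma rootAvg_fourier {n : ℕ} (hn : n ≠ 0) (m : ℤ) :
    rootAvg n (fourier m) = if (n : ℤ) ∣ m then 1 else 0 := by
  have : NeZero n := ⟨hn⟩
  have hn' : (n : ℂ) ≠ 0 := mod_cast hn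
  rw [rootAvg, ← sum_zmod_val n fun k => fourier m (rootPt n k)]
  simp_rw [fourier_rootPt, mul_comm (m : ZMod n), sum_stdAddChar_mul,
    ZMod.intCast_zmod_eq_zero_iff_dvd]
  split_ifs <;> simp [hn']

lemma tendsto_rootAvg_fourier (m : ℤ) :
    Tendsto (fun n => rootAvg n (fourier m)) atTop (𝓝 (∫ t, fourier m t ∂arc)) := by
  rw [integral_fourier]
  refine tendsto_const_nhds.congr' ?_
  filter_upwards [eventually_gt_atTop m.natAbs] with n hn
  rw [rootAvg_fourier (by omega)]
  refine if_congr ⟨fun h => by simp [h], fun h => ?_⟩ rfl rfl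
  exact Int.eq_zero_of_abs_lt_dvd h (by rw [Int.abs_eq_natAbs]; omega)

lemma tendsto_rootAvg_of_mem_span_fourier {f : C(Torus, ℂ)}
    (hf : f ∈ Submodule.span ℂ (Set.range (fourier : ℤ → C(Torus, ℂ)))) :
    Tendsto (fun n => rootAvg n f) atTop (𝓝 (∫ t, f t ∂arc)) := by
  have hint : ∀ f : C(Torus, ℂ), Integrable f arc := fun f =>
    f.continuous.integrable_of_hasCompactSupport (.of_compactSpace _)
  induction hf using Submodule.span_induction with
  | mem f hf =>
    obtain ⟨m, rfl⟩ := hf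
    exact tendsto_rootAvg_fourier m
  | zero => simp [rootAvg]
  | add f g _ _ hf hg =>
    simp_rw [ContinuousMap.add_apply, integral_add (hint f) (hint g)]
    refine (hf.add hg).congr fun n => ?_
    simp [rootAvg, Finset.sum_add_distrib, mul_add]
  | smul c f _ hf =>
    simp_rw [ContinuousMap.smul_apply, integral_smul]
    refine (hf.const_smul c).congr fun n => ?_
    simp [rootAvg, Finset.mul_sum, mul_left_comm]

lemma tendsto_rootAvg (f : C(Torus, ℂ)) :
    Tendsto (fun n => rootAvg n f) atTop (𝓝 (∫ t, f t ∂arc)) := by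
  have hcont : Continuous fun f : C(Torus, ℂ) => ∫ t, f t ∂arc :=
    (continuous_integral.comp (ContinuousMap.toLp 1 arc ℂ).continuous).congr fun f =>
      integral_congr_ae (ContinuousMap.coeFn_toLp arc f)
  have hclosed : IsClosed
      {f : C(Torus, ℂ) | Tendsto (fun n => rootAvg n f) atTop (𝓝 (∫ t, f t ∂arc))} :=
    (LipschitzWith.uniformEquicontinuous _ 1
      lipschitzWith_rootAvg).equicontinuous.isClosed_setOfPred_tendsto hcont
  have hmem :
      f ∈ (Submodule.span ℂ (Set.range (fourier : ℤ → C(Torus, ℂ)))).topologicalClosure := by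
    rw [span_fourier_closure_eq_top]
    trivial
  exact closure_minimal (fun f hf => tendsto_rootAvg_of_mem_span_fourier hf) hclosed hmem

lemma tendsto_of_eventually_dist_lt {α κ M : Type*} [PseudoMetricSpace M] {l : Filter α}
    {k : Filter κ} [k.NeBot] {A : α → M} {p : κ → α → M} {q : κ → M} {L : M}
    (hp : ∀ s, Tendsto (p s) l (𝓝 (q s))) (hq : Tendsto q k (𝓝 L))
    (hA : ∀ ε > 0, ∀ᶠ s in k, ∀ᶠ n in l, dist (A n) (p s n) < ε) : Tendsto A l (𝓝 L) := by
  refine Metric.tendsto_nhds.2 fun δ hδ => ?_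
  have hδ3 : 0 < δ / 3 := by positivity
  obtain ⟨s, hAs, hqs⟩ := ((hA _ hδ3).and (Metric.tendsto_nhds.1 hq _ hδ3)).exists
  filter_upwards [hAs, Metric.tendsto_nhds.1 (hp s) _ hδ3] with n hAn hpn
  linarith [dist_triangle4 (A n) (p s n) (q s) L]

lemma tendsto_integral_of_norm_sub_rootAvg_le {H : ℂ → ℂ} (hH : Continuous H)
    (hc : HasCompactSupport H) {a : ℤ → ℂ} {φ : L2}
    (hφ : HasSum (fun m => a m • (fourierLp 2 m : L2)) φ) {A : ℕ → ℂ} {W : Finset ℤ → ℝ}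
    (hA : ∀ ε > 0, ∃ C, ∀ s, ∀ n ≠ 0, ‖A n - rootAvg n fun t => H (trigPoly a s t)‖ ≤
      ε + C * (∑' m : {m // m ∉ s}, ‖a m‖ ^ 2 + W s / n)) :
    Tendsto A atTop (𝓝 (∫ t, H (φ t) ∂arc)) := by
  have hint : Tendsto (fun s => ∫ t, H (trigPoly a s t) ∂arc) atTop (𝓝 (∫ t, H (φ t) ∂arc)) := by
    refine (((continuous_integral_comp_of_hasCompactSupport hH hc).tendsto φ).comp hφ).congr
      fun s => integral_congr_ae ?_
    simp only [← toLp_trigPoly]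
    filter_upwards [ContinuousMap.coeFn_toLp (p := 2) (𝕜 := ℂ) arc (trigPoly a s)] with t ht
    rw [ht]
  refine tendsto_of_eventually_dist_lt
    (fun s => tendsto_rootAvg ⟨_, hH.comp (trigPoly a s).continuous⟩) hint fun ε hε => ?_
  obtain ⟨C, hC⟩ := hA _ (half_pos hε)
  have htail : Tendsto (fun s : Finset ℤ => ε / 2 + C * ∑' m : {m // m ∉ s}, ‖a m‖ ^ 2) atTop
      (𝓝 (ε / 2 + C * 0)) :=
    ((tendsto_tsum_compl_atTop_zero fun m => ‖a m‖ ^ 2).const_mul C).const_add _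
  filter_upwards [htail.eventually_lt_const (u := ε) (by simpa using half_lt_self hε)] with s hs
  have hlim : Tendsto (fun n : ℕ => ε / 2 + C * (∑' m : {m // m ∉ s}, ‖a m‖ ^ 2 + W s / n)) atTop
      (𝓝 (ε / 2 + C * (∑' m : {m // m ∉ s}, ‖a m‖ ^ 2 + 0))) :=
    (((tendsto_const_div_atTop_nhds_zero_nat (W s)).const_add _).const_mul C).const_add _
  rw [add_zero] at hlim
  filter_upwards [hlim.eventually_lt_const hs, eventually_ne_atTop 0] with n hn hn0
  rw [dist_eq_norm]
  exact (hC s n hn0).trans_lt hn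

end RootAverages

section RieszSequence

variable {𝕜 E F ι : Type*} [RCLike 𝕜] [NormedAddCommGroup F] [InnerProductSpace 𝕜 F]

lemma inner_eq_of_hasSum_of_orthonormal {v : ι → F} (hv : Orthonormal 𝕜 v) {a : ι → 𝕜} {x : F}
    (ha : HasSum (fun i => a i • v i) x) (i : ι) : ⟪v i, x⟫_𝕜 = a i := by
  classical
  have hinner : HasSum (fun k => ⟪v i, a k • v k⟫_𝕜) ⟪v i, x⟫_𝕜 := ha.mapL (innerSL 𝕜 (v i))
  simp_rw [inner_smul_right, orthonormal_iff_ite.1 hv, mul_ite, mul_one, mul_zero] at hinner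
  exact hinner.unique (by
    simpa using hasSum_single (f := fun k => if i = k then a k else 0) i fun k hk => if_neg hk.symm)

variable [NormedAddCommGroup E] [NormedSpace 𝕜 E] {e : E ≃L[𝕜] F} {v : ι → E}

lemma hasSum_smul_map_iff {a : ι → 𝕜} {x : E} :
    HasSum (fun i => a i • (e ∘ v) i) (e x) ↔ HasSum (fun i => a i • v i) x := by
  simpa using e.hasSum' (f := fun i => a i • v i) (x := x)

variable [CompleteSpace F]

lemma summable_smul_iff_summable_norm_sq_of_orthonormal {v : ι → F} (hv : Orthonormal 𝕜 v)
    {a : ι → 𝕜} : Summable (fun i => a i • v i) ↔ Summable fun i => ‖a i‖ ^ 2 := by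
  simpa using hv.orthogonalFamily.summable_iff_norm_sq_summable a

lemma exists_hasSum_of_mem_topologicalClosure_span {v : ι → F} (hv : Orthonormal 𝕜 v) {x : F}
    (hx : x ∈ (Submodule.span 𝕜 (Set.range v)).topologicalClosure) :
    ∃ a : ι → 𝕜, HasSum (fun i => a i • v i) x := by
  have hrange := hv.orthogonalFamily.range_linearIsometry
  simp only [LinearIsometry.toSpanSingleton, LinearMap.range_toSpanSingleton,
    ← Submodule.span_range_eq_iSup] at hrange
  rw [← hrange] at hx
  obtain ⟨a, rfl⟩ := hx
  exact ⟨a, hv.orthogonalFamily.hasSum_linearIsometry a⟩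

lemma summable_norm_sq_of_hasSum_smul (hv : Orthonormal 𝕜 (e ∘ v)) {a : ι → 𝕜} {x : E}
    (ha : HasSum (fun i => a i • v i) x) : Summable fun i => ‖a i‖ ^ 2 :=
  (summable_smul_iff_summable_norm_sq_of_orthonormal hv).1 (hasSum_smul_map_iff.2 ha).summable

lemma existsUnique_hasSum_smul (hv : Orthonormal 𝕜 (e ∘ v)) {x : E}
    (hx : x ∈ (Submodule.span 𝕜 (Set.range v)).topologicalClosure) :
    ∃! a : ι → 𝕜, HasSum (fun i => a i • v i) x := by
  have hex : e x ∈ (Submodule.span 𝕜 (Set.range (e ∘ v))).topologicalClosure := by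
    refine map_mem_closure e.continuous hx fun y hy => ?_
    rw [Set.range_comp]
    exact Submodule.apply_mem_span_image_of_mem_span (e : E →ₗ[𝕜] F) hy
  obtain ⟨a, ha⟩ := exists_hasSum_of_mem_topologicalClosure_span hv hex
  refine ⟨a, hasSum_smul_map_iff.1 ha, fun b hb => funext fun i => ?_⟩
  rw [← inner_eq_of_hasSum_of_orthonormal hv ha,
    inner_eq_of_hasSum_of_orthonormal hv (hasSum_smul_map_iff.2 hb)]

end RieszSequence

section BlockToeplitzDistribution

variable {ι : Type*} [Fintype ι]

section Fixed

variable {n : ℕ} [NeZero n]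

lemma sum_rootPt_eq (f : Torus → ℂ) :
    ∑ p : ZMod n × ι, f (rootPt n p.1.val) = n * Fintype.card ι * rootAvg n f := by
  have hn : (n : ℂ) ≠ 0 := mod_cast NeZero.ne n
  rw [Fintype.sum_prod_type, rootAvg, ← sum_zmod_val n fun k => f (rootPt n k)]
  simp only [Finset.sum_const, Finset.card_univ, nsmul_eq_mul, ← Finset.mul_sum]
  field_simp

variable {E : Type*} [NormedAddCommGroup E] [InnerProductSpace ℂ E] [FiniteDimensional ℂ E]
  {x : OrthonormalBasis (ZMod n × ι) ℂ E} {a : ℤ → ℂ} {T : E →ₗ[ℂ] E} [Nonempty ι]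

lemma IsBlockToeplitz.norm_mean_sub_rootAvg_le (hT : IsBlockToeplitz x a T)
    (ha : Summable fun m => ‖a m‖ ^ 2) (s : Finset ℤ) {f : Torus → ℂ} {z : ℂ} {ε C : ℝ}
    (hC : 0 ≤ C) (hz : ‖z - ∑ p : ZMod n × ι, f (rootPt n p.1.val)‖ ≤
      ε * Module.finrank ℂ E + C * hilbertSchmidtSq (T - circulant x a s)) :
    ‖(Module.finrank ℂ E : ℂ)⁻¹ * z - rootAvg n f‖ ≤
      ε + C * (∑' m : {m // m ∉ s}, ‖a m‖ ^ 2 + wrapBound a s / n) := by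
  have hcard : Module.finrank ℂ E = n * Fintype.card ι := by
    rw [Module.finrank_eq_card_basis x.toBasis, Fintype.card_prod, ZMod.card]
  have hn : (0 : ℝ) < n := mod_cast Nat.pos_of_ne_zero (NeZero.ne n)
  have hι : (0 : ℝ) < Fintype.card ι := mod_cast Fintype.card_pos
  have hdim : (n * Fintype.card ι : ℂ) ≠ 0 := mod_cast (mul_pos hn hι).ne'
  have hfactor : ((n * Fintype.card ι : ℕ) : ℂ)⁻¹ * z - rootAvg n f =
      (n * Fintype.card ι : ℂ)⁻¹ * (z - n * Fintype.card ι * rootAvg n f) := by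
    rw [mul_sub, inv_mul_cancel_left₀ hdim, Nat.cast_mul]
  rw [sum_rootPt_eq, hcard] at hz
  rw [hcard, hfactor, norm_mul, norm_inv, norm_mul, Complex.norm_natCast, Complex.norm_natCast,
    inv_mul_le_iff₀ (mul_pos hn hι)]
  calc ‖z - n * Fintype.card ι * rootAvg n f‖
      ≤ ε * (n * Fintype.card ι : ℕ) + C * (Fintype.card ι *
          (n * ∑' m : {m // m ∉ s}, ‖a m‖ ^ 2 + wrapBound a s)) := by
        refine hz.trans ?_
        gcongr
        exact hT.hilbertSchmidtSq_sub_circulant_le ha s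
    _ = n * Fintype.card ι * (ε + C * (∑' m : {m // m ∉ s}, ‖a m‖ ^ 2 + wrapBound a s / n)) := by
        push_cast
        field_simp

lemma IsBlockToeplitz.norm_mean_roots_sub_rootAvg_le (hT : IsBlockToeplitz x a T)
    (hsymm : T.IsSymmetric) (ha : Summable fun m => ‖a m‖ ^ 2) (s : Finset ℤ) {G : ℂ → ℂ}
    {ε C : ℝ} (hC : 0 ≤ C) (hG : ∀ x y, ‖G x - G y‖ ≤ ε + C * dist x y ^ 2) :
    ‖(Module.finrank ℂ E : ℂ)⁻¹ * (T.charpoly.roots.map G).sum -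
        rootAvg n fun t => G (trigPoly a s t)‖ ≤
      ε + C * (∑' m : {m // m ∉ s}, ‖a m‖ ^ 2 + wrapBound a s / n) := by
  refine hT.norm_mean_sub_rootAvg_le ha s (f := fun t => G (trigPoly a s t)) hC ?_
  have hroots : (T.charpoly.roots.map G).sum = ∑ i, G (hsymm.eigenvalues rfl i) := by
    rw [hsymm.roots_charpoly_eq_eigenvalues rfl, Multiset.map_map]
    rfl
  have hdist := sum_sq_norm_inner_mul_dist_eq_of_isSymmetric (hsymm.eigenvectorBasis rfl)
    (dftBasis x) hsymm (hsymm.apply_eigenvectorBasis rfl) (circulant_dftBasis x a s)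
  rw [sum_sq_norm_apply_eq_hilbertSchmidtSq] at hdist
  have hsum := norm_sum_sub_sum_le_of_orthonormalBasis _ _ hC hG hdist.le
  rw [Fintype.card_fin] at hsum
  rwa [hroots]

lemma IsBlockToeplitz.norm_mean_singularValues_sub_rootAvg_le (hT : IsBlockToeplitz x a T)
    (ha : Summable fun m => ‖a m‖ ^ 2) (s : Finset ℤ) {G : ℝ → ℂ} {ε C : ℝ} (hC : 0 ≤ C)
    (hG : ∀ x y, ‖G x - G y‖ ≤ ε + C * dist x y ^ 2) :
    ‖(Module.finrank ℂ E : ℂ)⁻¹ * (∑ k ∈ Finset.range (Module.finrank ℂ E),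
        G (T.singularValues k)) - rootAvg n fun t => G ‖trigPoly a s t‖‖ ≤
      ε + 2 * C * (∑' m : {m // m ∉ s}, ‖a m‖ ^ 2 + wrapBound a s / n) := by
  refine hT.norm_mean_sub_rootAvg_le ha s (f := fun t => G ‖trigPoly a s t‖) (by positivity) ?_
  have hsymm := T.isSymmetric_adjoint_comp_self
  have hdist := sum_sq_norm_inner_mul_dist_le_of_adjoint_comp_self (T := T)
    (hsymm.eigenvectorBasis rfl)
    (dftBasis x) (σ := fun i => T.singularValues i) (fun i => T.singularValues_nonneg i)
    (fun i => by
      rw [← RCLike.ofReal_pow, T.sq_singularValues_fin rfl]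
      exact hsymm.apply_eigenvectorBasis rfl i) (circulant_dftBasis x a s)
  have hsum := norm_sum_sub_sum_le_of_orthonormalBasis _ _ hC hG hdist
  rwa [Fintype.card_fin, ← Finset.sum_range fun k => G (T.singularValues k), ← mul_assoc,
    mul_comm C] at hsum

end Fixed

variable [Nonempty ι] {E : ℕ → Type*} [∀ n, NormedAddCommGroup (E n)]
  [∀ n, InnerProductSpace ℂ (E n)] [∀ n, FiniteDimensional ℂ (E n)] {a : ℤ → ℂ}
  {T : ∀ n, E n →ₗ[ℂ] E n} {φ : L2}

theorem tendsto_mean_roots_of_isBlockToeplitz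
    (hT : ∀ n [NeZero n], ∃ x : OrthonormalBasis (ZMod n × ι) ℂ (E n), IsBlockToeplitz x a (T n))
    (hsymm : ∀ n, (T n).IsSymmetric) (hφ : HasSum (fun m => a m • (fourierLp 2 m : L2)) φ)
    {G : ℂ → ℂ} (hG : Continuous G) (hc : HasCompactSupport G) :
    Tendsto (fun n => (Module.finrank ℂ (E n) : ℂ)⁻¹ * ((T n).charpoly.roots.map G).sum) atTop
      (𝓝 (∫ t, G (φ t) ∂arc)) := by
  have ha := (summable_smul_iff_summable_norm_sq_of_orthonormal orthonormal_fourier).1 hφ.summable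
  refine tendsto_integral_of_norm_sub_rootAvg_le hG hc hφ (W := wrapBound a) fun ε hε => ?_
  obtain ⟨C, hC, hmod⟩ := exists_modulus_of_hasCompactSupport hG hc hε
  refine ⟨C, fun s n hn => ?_⟩
  have : NeZero n := ⟨hn⟩
  obtain ⟨x, hx⟩ := hT n
  exact hx.norm_mean_roots_sub_rootAvg_le (hsymm n) ha s hC hmod

theorem tendsto_mean_singularValues_of_isBlockToeplitz
    (hT : ∀ n [NeZero n], ∃ x : OrthonormalBasis (ZMod n × ι) ℂ (E n), IsBlockToeplitz x a (T n))
    (hφ : HasSum (fun m => a m • (fourierLp 2 m : L2)) φ) {G : ℝ → ℂ} (hG : Continuous G)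
    (hc : HasCompactSupport G) :
    Tendsto (fun n => (Module.finrank ℂ (E n) : ℂ)⁻¹ *
      ∑ k ∈ Finset.range (Module.finrank ℂ (E n)), G ((T n).singularValues k)) atTop
      (𝓝 (∫ t, G ‖φ t‖ ∂arc)) := by
  have ha := (summable_smul_iff_summable_norm_sq_of_orthonormal orthonormal_fourier).1 hφ.summable
  have hcnorm : HasCompactSupport fun z : ℂ => G ‖z‖ := by
    rw [hasCompactSupport_iff_eventuallyEq, Filter.coclosedCompact_eq_cocompact] at hc ⊢
    exact (tendsto_norm_cocompact_atTop.mono_right atTop_le_cocompact).eventually hc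
  refine tendsto_integral_of_norm_sub_rootAvg_le (hG.comp continuous_norm) hcnorm hφ
    (W := wrapBound a) fun ε hε => ?_
  obtain ⟨C, hC, hmod⟩ := exists_modulus_of_hasCompactSupport hG hc hε
  refine ⟨2 * C, fun s n hn => ?_⟩
  have : NeZero n := ⟨hn⟩
  obtain ⟨x, hx⟩ := hT n
  exact hx.norm_mean_singularValues_sub_rootAvg_le ha s hC hmod

end BlockToeplitzDistribution

section Multiplication

/-- Multiplication of `L²` functions by continuous functions, as a bounded bilinear map; the
C⋆-algebraic structure is added in `mulOp`. -/
noncomputable def mulCLM : C(Torus, ℂ) →L[ℂ] L2 →L[ℂ] L2 :=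
  ((ContinuousLinearMap.mul ℂ ℂ).holderL arc ∞ 2 2).comp (ContinuousMap.toLp ∞ arc ℂ)

lemma coeFn_mulCLM (g : C(Torus, ℂ)) (f : L2) : mulCLM g f =ᵐ[arc] fun t => g t * f t := by
  filter_upwards [ContinuousLinearMap.coeFn_holder (ContinuousLinearMap.mul ℂ ℂ) (r := 2)
    (ContinuousMap.toLp ∞ arc ℂ g) f, ContinuousMap.coeFn_toLp (p := ∞) (𝕜 := ℂ) arc g]
    with t hholder hg
  rw [← hg]
  exact hholder

lemma mulCLM_mul (g h : C(Torus, ℂ)) (f : L2) : mulCLM (g * h) f = mulCLM g (mulCLM h f) := by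
  refine Lp.ext ?_
  filter_upwards [coeFn_mulCLM (g * h) f, coeFn_mulCLM g (mulCLM h f), coeFn_mulCLM h f]
    with t h₁ h₂ h₃
  rw [h₁, h₂, h₃, ContinuousMap.mul_apply, mul_assoc]

lemma inner_mulCLM_star (g : C(Torus, ℂ)) (f h : L2) :
    ⟪mulCLM (star g) f, h⟫_ℂ = ⟪f, mulCLM g h⟫_ℂ := by
  rw [L2.inner_def, L2.inner_def]
  refine integral_congr_ae ?_
  filter_upwards [coeFn_mulCLM (star g) f, coeFn_mulCLM g h] with t hf hh
  rw [hf, hh, RCLike.inner_apply, RCLike.inner_apply, map_mul, ContinuousMap.star_apply,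
    starRingEnd_apply, star_star]
  ring

/-- The representation of the C⋆-algebra `C(𝕋)` on `L²(𝕋)` by multiplication operators. -/
noncomputable def mulOp : C(Torus, ℂ) →⋆ₐ[ℂ] (L2 →L[ℂ] L2) :=
  { AlgHom.ofLinearMap (mulCLM : C(Torus, ℂ) →ₗ[ℂ] L2 →L[ℂ] L2)
      (ContinuousLinearMap.ext fun f => Lp.ext ((coeFn_mulCLM 1 f).trans (by simp)))
      fun g h => ContinuousLinearMap.ext (mulCLM_mul g h) with
    map_star' := fun g => (ContinuousLinearMap.eq_adjoint_iff _ _).2 (inner_mulCLM_star g) }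

lemma coeFn_mulOp (g : C(Torus, ℂ)) (f : L2) : mulOp g f =ᵐ[arc] fun t => g t * f t :=
  coeFn_mulCLM g f

lemma continuous_mulOp : Continuous mulOp := mulCLM.continuous

lemma mulOp_toLp (g h : C(Torus, ℂ)) :
    mulOp g (ContinuousMap.toLp 2 arc ℂ h) = ContinuousMap.toLp 2 arc ℂ (g * h) := by
  refine Lp.ext ?_
  filter_upwards [coeFn_mulOp g (ContinuousMap.toLp 2 arc ℂ h),
    ContinuousMap.coeFn_toLp (p := 2) (𝕜 := ℂ) arc h,
    ContinuousMap.coeFn_toLp (p := 2) (𝕜 := ℂ) arc (g * h)] with t hmul hh hgh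
  rw [hmul, hh, hgh, ContinuousMap.mul_apply]

lemma inner_mulOp_left (g : C(Torus, ℂ)) (f h : L2) :
    ⟪mulOp g f, h⟫_ℂ = ⟪f, mulOp (star g) h⟫_ℂ := by
  rw [map_star, ContinuousLinearMap.star_eq_adjoint, ContinuousLinearMap.adjoint_inner_right]

lemma aeval_fourier_one_apply (P : Polynomial ℂ) (t : Torus) :
    Polynomial.aeval (fourier 1 : C(Torus, ℂ)) P t = P.eval (pt t) := by
  have h := Polynomial.aeval_algHom_apply (ContinuousMap.evalAlgHom ℂ ℂ t) (fourier 1) P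
  rw [ContinuousMap.evalAlgHom_apply, fourier_eq_zpow, zpow_one, Polynomial.coe_aeval_eq_eval] at h
  exact h.symm

lemma polyMul_eq_mulOp (P : Polynomial ℂ) (f : L2) :
    polyMul P f = mulOp (Polynomial.aeval (fourier 1) P) f := by
  refine Lp.ext ?_
  filter_upwards [polyMul_ae P f, coeFn_mulOp (Polynomial.aeval (fourier 1) P) f] with t hP hmul
  rw [hP, hmul, aeval_fourier_one_apply, mul_comm]

end Multiplication

section HardyMultipliers

/-- The continuous multipliers of the Hardy space, that is, the disc algebra: those `g` with
`g H² ⊆ H²`. -/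
def hardyMultipliers : Subalgebra ℂ C(Torus, ℂ) where
  carrier := {g | ∀ f ∈ hardy, mulOp g f ∈ hardy}
  mul_mem' {g h} hg hh f hf := by
    rw [map_mul]
    exact hg _ (hh f hf)
  add_mem' {g h} hg hh f hf := by
    rw [map_add]
    exact hardy.add_mem (hg f hf) (hh f hf)
  algebraMap_mem' c f hf := by
    rw [AlgHomClass.commutes]
    exact hardy.smul_mem c hf

lemma isClosed_hardyMultipliers : IsClosed (hardyMultipliers : Set C(Torus, ℂ)) := by
  have hset : (hardyMultipliers : Set C(Torus, ℂ)) = ⋂ f ∈ hardy, (mulOp · f) ⁻¹' hardy := by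
    ext g
    simp only [Set.mem_iInter]
    rfl
  rw [hset]
  exact isClosed_biInter fun f _ =>
    isClosed_hardy.preimage (continuous_mulOp.clm_apply continuous_const)

lemma aeval_mem_hardyMultipliers (P : Polynomial ℂ) :
    Polynomial.aeval (fourier 1 : C(Torus, ℂ)) P ∈ hardyMultipliers := fun f hf => by
  rw [← polyMul_eq_mulOp]
  exact polyMul_mem_hardy P hf

lemma tsum_pow_mem_hardyMultipliers {g : C(Torus, ℂ)} (hg : g ∈ hardyMultipliers) (hg1 : ‖g‖ < 1) :
    ∑' n, g ^ n ∈ hardyMultipliers :=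
  isClosed_hardyMultipliers.mem_of_tendsto (summable_geometric_of_norm_lt_one hg1).hasSum
    (Eventually.of_forall fun _ => sum_mem fun n _ => pow_mem hg n)

lemma exists_mem_hardyMultipliers_aeval_linear_mul_eq_one {c : ℂ} (hc : ‖c‖ < 1) :
    ∃ g ∈ hardyMultipliers, Polynomial.aeval (fourier 1 : C(Torus, ℂ))
      (1 - Polynomial.C c * Polynomial.X) * g = 1 := by
  have hmem := aeval_mem_hardyMultipliers (Polynomial.C c * Polynomial.X)
  have hnorm :
      ‖Polynomial.aeval (fourier 1 : C(Torus, ℂ)) (Polynomial.C c * Polynomial.X)‖ < 1 := by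
    rwa [map_mul, Polynomial.aeval_C, Polynomial.aeval_X, ← Algebra.smul_def, norm_smul,
      fourier_norm, mul_one]
  refine ⟨_, tsum_pow_mem_hardyMultipliers hmem hnorm, ?_⟩
  rw [map_sub, map_one]
  exact mul_neg_geom_series _ hnorm

variable {d : ℕ} (lam : Fin d → 𝔻) (n : ℕ)

lemma exists_mem_hardyMultipliers_aeval_denPoly_mul_eq_one :
    ∃ g ∈ hardyMultipliers, Polynomial.aeval (fourier 1 : C(Torus, ℂ)) (denPoly lam n) * g = 1 := by
  have hfactor (i : Fin d) := exists_mem_hardyMultipliers_aeval_linear_mul_eq_one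
    ((RCLike.norm_conj (lam i : ℂ)).trans_lt (lam i).norm_lt_one)
  choose g hg hmul using hfactor
  refine ⟨∏ i, g i ^ n, prod_mem fun i _ => pow_mem (hg i) n, ?_⟩
  rw [denPoly, map_prod, ← Finset.prod_mul_distrib]
  exact Finset.prod_eq_one fun i _ => by rw [map_pow, ← mul_pow, hmul, one_pow]

variable {lam n}

lemma mem_hardyMultipliers_of_mul_aeval_denPoly {g : C(Torus, ℂ)} {P : Polynomial ℂ}
    (h : g * Polynomial.aeval (fourier 1) (denPoly lam n) = Polynomial.aeval (fourier 1) P) :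
    g ∈ hardyMultipliers := by
  obtain ⟨q, hq, hmul⟩ := exists_mem_hardyMultipliers_aeval_denPoly_mul_eq_one lam n
  have hg : g = Polynomial.aeval (fourier 1) P * q := by rw [← h, mul_assoc, hmul, mul_one]
  exact hg ▸ mul_mem (aeval_mem_hardyMultipliers P) hq

variable (lam n)

lemma modelGen_mul_aeval_denPoly (k : ℕ) :
    modelGen lam n k * Polynomial.aeval (fourier 1) (denPoly lam n) =
      Polynomial.aeval (fourier 1) (Polynomial.X ^ k : Polynomial ℂ) := by
  ext t
  rw [ContinuousMap.mul_apply, aeval_fourier_one_apply, aeval_fourier_one_apply,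
    Polynomial.eval_pow, Polynomial.eval_X]
  exact div_mul_cancel₀ _ (denPoly_ne_zero lam n t)

lemma modelGen_mem_hardyMultipliers (k : ℕ) : modelGen lam n k ∈ hardyMultipliers :=
  mem_hardyMultipliers_of_mul_aeval_denPoly (modelGen_mul_aeval_denPoly lam n k)

lemma blaschkePow_mem_hardyMultipliers : blaschkePow lam n ∈ hardyMultipliers := by
  refine mem_hardyMultipliers_of_mul_aeval_denPoly (lam := lam) (n := n) (P := numPoly lam n) ?_
  ext t
  rw [ContinuousMap.mul_apply, aeval_fourier_one_apply, aeval_fourier_one_apply]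
  exact blaschkePow_mul_den lam n t

end HardyMultipliers

lemma mem_of_inner_orthogonal_inf_eq_zero {𝕜 E : Type*} [RCLike 𝕜] [NormedAddCommGroup E]
    [InnerProductSpace 𝕜 E] {S H : Submodule 𝕜 E} [S.HasOrthogonalProjection] (hSH : S ≤ H) {f : E}
    (hf : f ∈ H) (horth : ∀ k ∈ Sᗮ ⊓ H, ⟪k, f⟫_𝕜 = 0) : f ∈ S := by
  obtain ⟨s, hs, k, hk, rfl⟩ : ∃ s ∈ S, ∃ k ∈ Sᗮ ⊓ H, s + k = f := by
    rwa [← Submodule.mem_sup, Submodule.sup_orthogonal_inf_of_hasOrthogonalProjection hSH]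
  have hk0 : k = 0 := by
    have h := horth k hk
    rwa [inner_add_right, Submodule.inner_left_of_mem_orthogonal hs hk.1, zero_add,
      inner_self_eq_zero] at h
  rwa [hk0, add_zero]

section InnerFunction

variable (θ : unitary C(Torus, ℂ))

/-- Multiplication by the integer power `θᵐ` of a unimodular continuous function `θ`. -/
noncomputable def zpowMul (m : ℤ) : L2 →L[ℂ] L2 := mulOp (θ ^ m : unitary C(Torus, ℂ))

lemma zpowMul_zero (f : L2) : zpowMul θ 0 f = f := by
  rw [zpowMul, zpow_zero, OneMemClass.coe_one, map_one, one_apply_eq_self]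

lemma zpowMul_zpowMul (m k : ℤ) (f : L2) :
    zpowMul θ m (zpowMul θ k f) = zpowMul θ (m + k) f := by
  rw [zpowMul, zpowMul, zpowMul, zpow_add, Submonoid.coe_mul, map_mul, mul_apply_eq_comp]

lemma inner_zpowMul_left (m : ℤ) (f g : L2) :
    ⟪zpowMul θ m f, g⟫_ℂ = ⟪f, zpowMul θ (-m) g⟫_ℂ := by
  rw [zpowMul, zpowMul, inner_mulOp_left, ← Unitary.coe_star, Unitary.star_eq_inv, zpow_neg]

lemma inner_zpowMul_zpowMul (m k : ℤ) (f g : L2) :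
    ⟪zpowMul θ m f, zpowMul θ k g⟫_ℂ = ⟪zpowMul θ (m - k) f, g⟫_ℂ := by
  rw [inner_zpowMul_left, inner_zpowMul_left, zpowMul_zpowMul, neg_sub, sub_eq_neg_add]

/-- The model space `K_{θⁿ}`. -/
noncomputable def powModel (n : ℕ) : Submodule ℂ L2 :=
  modelSpace ((θ ^ n : unitary C(Torus, ℂ)) : C(Torus, ℂ))

variable {θ}

lemma mem_powModel {n : ℕ} {f : L2} :
    f ∈ powModel θ n ↔ f ∈ hardy ∧ ∀ g ∈ hardy, ⟪zpowMul θ n g, f⟫_ℂ = 0 := by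
  refine and_congr_right fun _ => (Submodule.mem_orthogonal _ _).trans
    ⟨fun h g hg => h _ ⟨g, hg, ?_⟩, ?_⟩
  · rw [zpowMul, zpow_natCast]
    exact coeFn_mulOp _ g
  · rintro h u ⟨g, hg, hu⟩
    have hug : u = zpowMul θ n g := by
      rw [zpowMul, zpow_natCast]
      exact Lp.ext (hu.trans (coeFn_mulOp _ g).symm)
    exact hug ▸ h g hg

variable (hθ : (θ : C(Torus, ℂ)) ∈ hardyMultipliers)
include hθ

lemma zpowMul_mem_hardy {m : ℤ} (hm : 0 ≤ m) {f : L2} (hf : f ∈ hardy) :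
    zpowMul θ m f ∈ hardy := by
  lift m to ℕ using hm
  rw [zpowMul, zpow_natCast, SubmonoidClass.coe_pow]
  exact pow_mem hθ m f hf

lemma inner_zpowMul_eq_zero {f g : L2} (hf : f ∈ hardy) (hg : g ∈ powModel θ 1) {m : ℤ}
    (hm : 0 < m) : ⟪zpowMul θ m f, g⟫_ℂ = 0 := by
  have h := (mem_powModel.1 hg).2 _ (zpowMul_mem_hardy hθ (Int.sub_nonneg_of_le hm) hf)
  rwa [zpowMul_zpowMul, Nat.cast_one, zero_add, add_sub_cancel] at h

lemma inner_zpowMul_zpowMul_of_mem_powModel {f g : L2} (hf : f ∈ powModel θ 1)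
    (hg : g ∈ powModel θ 1) (m k : ℤ) :
    ⟪zpowMul θ m f, zpowMul θ k g⟫_ℂ = if m = k then ⟪f, g⟫_ℂ else 0 := by
  rw [inner_zpowMul_zpowMul]
  rcases lt_trichotomy m k with h | rfl | h
  · rw [if_neg h.ne, inner_zpowMul_left, ← inner_conj_symm,
      inner_zpowMul_eq_zero hθ (mem_powModel.1 hg).1 hf (by omega), map_zero]
  · rw [if_pos rfl, sub_self, zpowMul_zero]
  · rw [if_neg h.ne', inner_zpowMul_eq_zero hθ (mem_powModel.1 hf).1 hg (by omega)]

lemma zpowMul_mem_powModel {f : L2} (hf : f ∈ powModel θ 1) {j n : ℕ} (hj : j < n) :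
    zpowMul θ j f ∈ powModel θ n := by
  refine mem_powModel.2
    ⟨zpowMul_mem_hardy hθ j.cast_nonneg (mem_powModel.1 hf).1, fun g hg => ?_⟩
  rw [inner_zpowMul_zpowMul, inner_zpowMul_eq_zero hθ hg hf (by omega)]

lemma zpowMul_neg_one_mem_hardy {f : L2} (hf : f ∈ hardy)
    (horth : ∀ k ∈ powModel θ 1, ⟪k, f⟫_ℂ = 0) : zpowMul θ (-1) f ∈ hardy := by
  obtain ⟨S, hS⟩ : ∃ S : Submodule ℂ L2, ∀ g, g ∈ S ↔ zpowMul θ (-1) g ∈ hardy :=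
    ⟨hardy.comap (zpowMul θ (-1) : L2 →ₗ[ℂ] L2), fun _ => Submodule.mem_comap⟩
  have hclosed : IsClosed (S : Set L2) := by
    convert isClosed_hardy.preimage (zpowMul θ (-1)).continuous
    exact Set.ext hS
  have : CompleteSpace S := hclosed.completeSpace_coe
  have hSle : S ≤ hardy := fun g hg => by
    have hmem := zpowMul_mem_hardy hθ zero_le_one ((hS g).1 hg)
    rwa [zpowMul_zpowMul, add_neg_cancel, zpowMul_zero] at hmem
  refine (hS f).1 (mem_of_inner_orthogonal_inf_eq_zero hSle hf fun k hk => horth k ?_)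
  refine mem_powModel.2 ⟨hk.2, fun g hg => hk.1 _ ((hS _).2 ?_)⟩
  rwa [Nat.cast_one, zpowMul_zpowMul, neg_add_cancel, zpowMul_zero]

lemma eq_zero_of_inner_zpowMul_eq_zero {n : ℕ} {f : L2} (hf : f ∈ powModel θ n)
    (horth : ∀ j < n, ∀ k ∈ powModel θ 1, ⟪zpowMul θ j k, f⟫_ℂ = 0) : f = 0 := by
  have hdiv (j : ℕ) (hj : j ≤ n) : zpowMul θ (-j) f ∈ hardy := by
    induction j with
    | zero => simpa only [Nat.cast_zero, neg_zero, zpowMul_zero] using (mem_powModel.1 hf).1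
    | succ j ih =>
      have hmem := zpowMul_neg_one_mem_hardy hθ (ih (Nat.le_of_succ_le hj)) fun k hk => by
        rw [← inner_zpowMul_left, horth j hj k hk]
      rwa [zpowMul_zpowMul, ← neg_add_rev, ← Nat.cast_succ] at hmem
  have hself := (mem_powModel.1 hf).2 _ (hdiv n le_rfl)
  rwa [zpowMul_zpowMul, add_neg_cancel, zpowMul_zero, inner_self_eq_zero] at hself

lemma orthonormal_zpowMul {ι : Type*} {e : ι → L2} (he : Orthonormal ℂ e)
    (hmem : ∀ i, e i ∈ powModel θ 1) :
    Orthonormal ℂ fun p : ℤ × ι => zpowMul θ p.1 (e p.2) := by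
  classical
  rw [orthonormal_iff_ite]
  intro p q
  rw [inner_zpowMul_zpowMul_of_mem_powModel hθ (hmem _) (hmem _), orthonormal_iff_ite.1 he,
    ← ite_and]
  exact if_congr Prod.ext_iff.symm rfl rfl

lemma orthonormal_mulOp_toLp_zpow {g : C(Torus, ℂ)}
    (hg : ContinuousMap.toLp 2 arc ℂ g ∈ powModel θ 1) (hg1 : ‖ContinuousMap.toLp 2 arc ℂ g‖ = 1) :
    Orthonormal ℂ fun m : ℤ =>
      mulOp g (ContinuousMap.toLp 2 arc ℂ (θ ^ m : unitary C(Torus, ℂ))) := by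
  simp only [mulOp_toLp, mul_comm g]
  simp only [← mulOp_toLp]
  refine orthonormal_iff_ite.2 fun m k =>
    (inner_zpowMul_zpowMul_of_mem_powModel hθ hg hg m k).trans ?_
  rw [inner_self_eq_norm_sq_to_K, hg1, RCLike.ofReal_one, one_pow]

theorem exists_orthonormalBasis_powModel {ι : Type*} [Fintype ι]
    (e : OrthonormalBasis ι ℂ (powModel θ 1)) (n : ℕ) [NeZero n] :
    ∃ x : OrthonormalBasis (ZMod n × ι) ℂ (powModel θ n),
      ∀ p, (x p : L2) = zpowMul θ p.1.val (e p.2) := by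
  let v (p : ZMod n × ι) : powModel θ n :=
    ⟨zpowMul θ p.1.val (e p.2), zpowMul_mem_powModel hθ (e p.2).2 p.1.val_lt⟩
  have hinj : Function.Injective fun p : ZMod n × ι => ((p.1.val : ℤ), p.2) := fun p q h =>
    Prod.ext (ZMod.val_injective n (Nat.cast_injective (Prod.ext_iff.1 h).1)) (Prod.ext_iff.1 h).2
  have he : Orthonormal ℂ fun i => (e i : L2) :=
    e.orthonormal.comp_linearIsometry (powModel θ 1).subtypeₗᵢ
  have hv : Orthonormal ℂ v :=
    ((orthonormal_zpowMul hθ he fun i => (e i).2).comp _ hinj).codRestrict _ fun p => (v p).2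
  have hspan : (Submodule.span ℂ (Set.range v))ᗮ = ⊥ := by
    refine (Submodule.eq_bot_iff _).2 fun f hf => Subtype.ext
      (eq_zero_of_inner_zpowMul_eq_zero hθ f.2 fun j hj k hk => ?_)
    have hjn : ((j : ZMod n).val : ℤ) = j := by rw [ZMod.val_cast_of_lt hj]
    have hexpand := congrArg Subtype.val (e.sum_repr ⟨k, hk⟩)
    simp only [Submodule.coe_sum, Submodule.coe_smul] at hexpand
    rw [← hexpand, map_sum, sum_inner]
    refine Finset.sum_eq_zero fun i _ => ?_
    have h := (Submodule.mem_orthogonal _ _).1 hf _ (Submodule.subset_span ⟨((j : ZMod n), i), rfl⟩)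
    rw [Submodule.coe_inner] at h
    simp only [v, hjn] at h
    rw [map_smul, inner_smul_left, h, mul_zero]
  exact ⟨OrthonormalBasis.mkOfOrthogonalEqBot hv hspan, fun p => by
    rw [OrthonormalBasis.coe_of_orthogonal_eq_bot_mk]⟩

end InnerFunction

section Compression

variable {K : Submodule ℂ L2} [FiniteDimensional ℂ K] (hK : K ≤ hardyInf)

lemma inner_compression (ϕ : L2) (f g : K) :
    ⟪f, compression ϕ K hK g⟫_ℂ = ∫ t, (ϕ t * (g : L2) t) * conj ((f : L2) t) ∂arc := by
  have hproj : ⟪f, compression ϕ K hK g⟫_ℂ = ⟪(f : L2), (memLp_mul ϕ (hK g.2).2).toLp _⟫_ℂ :=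
    (Submodule.inner_orthogonalProjectionOnto_eq_of_mem_left f _).trans
      (Submodule.inner_orthogonalProjectionOnto_eq_of_mem_left (⟨f, (hK f.2).1⟩ : hardy) _)
  rw [hproj, L2.inner_def]
  refine integral_congr_ae ?_
  filter_upwards [MemLp.coeFn_toLp (memLp_mul ϕ (hK g.2).2)] with t ht
  rw [ht, RCLike.inner_apply]

lemma compression_isSymmetric {ϕ : L2} (hϕ : ∀ᵐ t ∂arc, (ϕ t).im = 0) :
    (compression ϕ K hK).IsSymmetric := fun f g => by
  rw [← inner_conj_symm, inner_compression, inner_compression, ← integral_conj]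
  refine integral_congr_ae ?_
  filter_upwards [hϕ] with t ht
  rw [map_mul, map_mul, Complex.conj_conj, Complex.conj_eq_iff_im.2 ht]
  ring

lemma inner_compression_toLp (h : C(Torus, ℂ)) (f g : K) :
    ⟪f, compression (ContinuousMap.toLp 2 arc ℂ h) K hK g⟫_ℂ = ⟪(f : L2), mulOp h g⟫_ℂ := by
  rw [inner_compression, L2.inner_def]
  refine integral_congr_ae ?_
  filter_upwards [ContinuousMap.coeFn_toLp (p := 2) (𝕜 := ℂ) arc h, coeFn_mulOp h g] with t hh hg
  rw [hh, hg, RCLike.inner_apply]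

lemma exists_inner_eq_inner_compression (f g : K) :
    ∃ w : L2, ∀ ϕ, ⟪w, ϕ⟫_ℂ = ⟪f, compression ϕ K hK g⟫_ℂ := by
  have hmem : MemLp (fun t => conj ((g : L2) t)) ∞ arc := (hK g.2).2.star
  refine ⟨(memLp_mul f hmem).toLp _, fun ϕ => ?_⟩
  rw [inner_compression, L2.inner_def]
  refine integral_congr_ae ?_
  filter_upwards [MemLp.coeFn_toLp (memLp_mul (f : L2) hmem)] with t ht
  rw [ht, RCLike.inner_apply, map_mul, Complex.conj_conj]
  ring

lemma hasSum_inner_compression {α : Type*} {ψ : α → L2} {ϕ : L2} (h : HasSum ψ ϕ) (f g : K) :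
    HasSum (fun i => ⟪f, compression (ψ i) K hK g⟫_ℂ) ⟪f, compression ϕ K hK g⟫_ℂ := by
  obtain ⟨w, hw⟩ := exists_inner_eq_inner_compression hK f g
  simp only [← hw]
  exact h.mapL (innerSL ℂ w)

lemma isBlockToeplitz_compression {θ : unitary C(Torus, ℂ)}
    (hθ : (θ : C(Torus, ℂ)) ∈ hardyMultipliers) {ι : Type*} [Fintype ι] {e : ι → L2}
    (he : Orthonormal ℂ e) (hmem : ∀ i, e i ∈ powModel θ 1) {n : ℕ} [NeZero n]
    {x : OrthonormalBasis (ZMod n × ι) ℂ K} (hx : ∀ p, (x p : L2) = zpowMul θ p.1.val (e p.2))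
    {a : ℤ → ℂ} {ϕ : L2}
    (hϕ : HasSum (fun m => a m • ContinuousMap.toLp 2 arc ℂ (θ ^ m : unitary C(Torus, ℂ))) ϕ) :
    IsBlockToeplitz x a (compression ϕ K hK) := by
  classical
  have hentry (q p : ZMod n × ι) : ⟪x q, compression ϕ K hK (x p)⟫_ℂ =
      if q.2 = p.2 then a ((q.1.val : ℤ) - p.1.val) else 0 := by
    refine (hasSum_inner_compression hK hϕ (x q) (x p)).unique ?_
    convert hasSum_ite_eq ((q.1.val : ℤ) - p.1.val)
      (if q.2 = p.2 then a ((q.1.val : ℤ) - p.1.val) else 0) using 2 with m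
    rw [← map_smul, inner_compression_toLp, map_smul, smul_apply, inner_smul_right, ← zpowMul,
      hx, hx, zpowMul_zpowMul, inner_zpowMul_zpowMul_of_mem_powModel hθ (hmem _) (hmem _),
      orthonormal_iff_ite.1 he]
    grind
  intro p
  rw [← x.sum_repr' (compression ϕ K hK (x p)), Fintype.sum_prod_type]
  simp only [hentry, ite_smul, zero_smul, Finset.sum_ite_eq', Finset.mem_univ, if_true]

end Compression

section Blaschke

variable {d : ℕ} (lam : Fin d → 𝔻)

lemma norm_blaschke (t : Torus) : ‖blaschke lam (pt t)‖ = 1 := by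
  rw [blaschke, norm_prod]
  refine Finset.prod_eq_one fun i _ => ?_
  rw [norm_div, ← conj_num, norm_mul, RCLike.norm_conj, norm_pt, mul_one,
    div_self (norm_ne_zero_iff.2 (num_ne_zero _ t))]

/-- The Blaschke product `B` as a unitary element of the C⋆-algebra `C(𝕋)`. -/
noncomputable def blaschkeUnitary : unitary C(Torus, ℂ) :=
  ⟨blaschkePow lam 1, by
    rw [Unitary.mem_iff_star_mul_self]
    ext t
    rw [ContinuousMap.mul_apply, ContinuousMap.star_apply, RCLike.star_def, RCLike.conj_mul]
    simp [blaschkePow, norm_blaschke]⟩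

lemma coe_blaschkeUnitary_zpow (m : ℤ) :
    ((blaschkeUnitary lam ^ m : unitary C(Torus, ℂ)) : C(Torus, ℂ)) = blaschkePow lam m := by
  ext t
  have h := map_zpow ((ContinuousMap.evalAlgHom ℂ ℂ t : C(Torus, ℂ) →* ℂ).comp
    (unitary C(Torus, ℂ)).subtype) (blaschkeUnitary lam) m
  exact h.trans (congrArg (· ^ m) (zpow_one _))

lemma blaschkeUnitary_mem_hardyMultipliers :
    (blaschkeUnitary lam : C(Torus, ℂ)) ∈ hardyMultipliers :=
  blaschkePow_mem_hardyMultipliers lam 1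

lemma blaschkeModel_eq_powModel (n : ℕ) :
    blaschkeModel lam n = powModel (blaschkeUnitary lam) n := by
  rw [blaschkeModel, powModel, ← zpow_natCast, coe_blaschkeUnitary_zpow]

lemma modelGen_eq_mul_fourier (n k : ℕ) : modelGen lam n k = modelGen lam n 0 * fourier k := by
  ext t
  simp only [ContinuousMap.mul_apply, fourier_eq_zpow, zpow_natCast, modelGen,
    ContinuousMap.coe_mk, pow_zero, one_div_mul_eq_div]

lemma toLp_modelGen_mem_hardy (n k : ℕ) :
    ContinuousMap.toLp 2 arc ℂ (modelGen lam n k) ∈ hardy := by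
  rw [modelGen_eq_mul_fourier, ← mulOp_toLp]
  exact modelGen_mem_hardyMultipliers lam n 0 _ (fourierLp_mem_hardy k)

lemma star_blaschkePow_mul_modelGen {n k : ℕ} (hk : k ≤ n * d) :
    star (blaschkePow lam n) * modelGen lam n k = star (modelGen lam n (n * d - k)) := by
  ext t
  have hpow : conj (pt t) ^ (n * d - k) * pt t ^ (n * d) = pt t ^ k := by
    rw [← pow_sub_mul_pow (pt t) hk, ← mul_assoc, ← mul_pow, conj_pt, one_pow, one_mul]
  have hclear : conj (blaschkePow lam n t) * conj ((denPoly lam n).eval (pt t)) * pt t ^ k =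
      conj (pt t) ^ (n * d - k) * (denPoly lam n).eval (pt t) := by
    rw [← map_mul, blaschkePow_mul_den, ← conj_num_mul, mul_left_comm, hpow]
  have hden := denPoly_ne_zero lam n t
  have hden' := (map_ne_zero (starRingEnd ℂ)).2 hden
  simp only [ContinuousMap.mul_apply, ContinuousMap.star_apply, RCLike.star_def, modelGen,
    ContinuousMap.coe_mk, map_div₀, map_pow]
  rw [mul_div_assoc', div_eq_div_iff hden hden', ← hclear]
  ring

lemma inner_fourierLp_eq_zero_of_mem_hardy {f : L2} (hf : f ∈ hardy) {m : ℤ} (hm : m < 0) :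
    ⟪(fourierLp 2 m : L2), f⟫_ℂ = 0 := by
  rw [← coe_fourierBasis, ← HilbertBasis.repr_apply_apply, ← fourierCoeff_eq_repr]
  exact mem_hardy.1 hf m hm

lemma inner_toLp_star_modelGen_eq_zero {f : L2} (hf : f ∈ hardy) (n : ℕ) {k : ℕ} (hk : 0 < k) :
    ⟪f, ContinuousMap.toLp 2 arc ℂ (star (modelGen lam n k))⟫_ℂ = 0 := by
  have hstar : star (fourier k : C(Torus, ℂ)) = fourier (-k) := by
    ext t
    exact fourier_neg.symm
  rw [modelGen_eq_mul_fourier, star_mul', hstar, ← mulOp_toLp, ← inner_mulOp_left,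
    ← inner_conj_symm]
  exact (map_eq_zero _).2 (inner_fourierLp_eq_zero_of_mem_hardy
    (modelGen_mem_hardyMultipliers lam n 0 f hf) (by omega))

variable {lam}

lemma toLp_modelGen_mem_blaschkeModel {n k : ℕ} (hk : k < n * d) :
    ContinuousMap.toLp 2 arc ℂ (modelGen lam n k) ∈ blaschkeModel lam n := by
  rw [blaschkeModel_eq_powModel, mem_powModel]
  refine ⟨toLp_modelGen_mem_hardy lam n k, fun g hg => ?_⟩
  rw [zpowMul, coe_blaschkeUnitary_zpow, inner_mulOp_left, mulOp_toLp,
    star_blaschkePow_mul_modelGen lam hk.le]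
  exact inner_toLp_star_modelGen_eq_zero lam hg n (Nat.sub_pos_of_lt hk)

variable (lam)

lemma isUnit_modelGen (n k : ℕ) : IsUnit (modelGen lam n k) :=
  (ContinuousMap.isUnit_iff_forall_ne_zero _).2 fun t =>
    div_ne_zero (pow_ne_zero k (pt_ne_zero t)) (denPoly_ne_zero lam n t)

lemma toLp_modelGen_ne_zero (n k : ℕ) : ContinuousMap.toLp 2 arc ℂ (modelGen lam n k) ≠ 0 :=
  ((ContinuousMap.toLp_injective arc).ne_iff' (map_zero _)).2 (isUnit_modelGen lam n k).ne_zero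

lemma exists_equiv_orthonormal_blaschkeLp (hd : 0 < d) :
    ∃ U : L2 ≃L[ℂ] L2, Orthonormal ℂ (U ∘ blaschkeLp lam) := by
  let c : ℂ := (‖ContinuousMap.toLp 2 arc ℂ (modelGen lam 1 0)‖ : ℂ)⁻¹
  have hmem :
      ContinuousMap.toLp 2 arc ℂ (c • modelGen lam 1 0) ∈ powModel (blaschkeUnitary lam) 1 := by
    rw [← blaschkeModel_eq_powModel, map_smul]
    exact Submodule.smul_mem _ _ (toLp_modelGen_mem_blaschkeModel (by omega))
  have hnorm : ‖ContinuousMap.toLp 2 arc ℂ (c • modelGen lam 1 0)‖ = 1 := by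
    rw [map_smul]
    exact norm_smul_inv_norm (toLp_modelGen_ne_zero lam 1 0)
  have hc : c ≠ 0 :=
    inv_ne_zero (Complex.ofReal_ne_zero.2 (norm_ne_zero_iff.2 (toLp_modelGen_ne_zero lam 1 0)))
  have hunit : IsUnit (c • modelGen lam 1 0) := (isUnit_modelGen lam 1 0).smul (Units.mk0 c hc)
  have hon := orthonormal_mulOp_toLp_zpow (blaschkeUnitary_mem_hardyMultipliers lam) hmem hnorm
  simp only [coe_blaschkeUnitary_zpow] at hon
  exact ⟨.ofUnit (hunit.map mulOp).unit, hon⟩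

lemma finrank_blaschkeModel_one_pos (hd : 0 < d) : 0 < Module.finrank ℂ (blaschkeModel lam 1) :=
  Module.finrank_pos_iff_exists_ne_zero.2 ⟨⟨_, toLp_modelGen_mem_blaschkeModel (k := 0) (by omega)⟩,
    (Submodule.mk_eq_zero _ _).not.2 (toLp_modelGen_ne_zero lam 1 0)⟩

theorem exists_isBlockToeplitz_blaschkeCompression {a : ℤ → ℂ} {ϕ : L2}
    (hϕ : HasSum (fun m => a m • blaschkeLp lam m) ϕ) (n : ℕ) [NeZero n] :
    ∃ x : OrthonormalBasis (ZMod n × Fin (Module.finrank ℂ (blaschkeModel lam 1))) ℂ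
      (blaschkeModel lam n), IsBlockToeplitz x a (blaschkeCompression lam ϕ n) := by
  have hθ := blaschkeUnitary_mem_hardyMultipliers lam
  let e := (stdOrthonormalBasis ℂ (blaschkeModel lam 1)).map
    (LinearIsometryEquiv.ofEq _ _ (blaschkeModel_eq_powModel lam 1))
  obtain ⟨x, hx⟩ := exists_orthonormalBasis_powModel hθ e n
  refine ⟨x.map (LinearIsometryEquiv.ofEq _ _ (blaschkeModel_eq_powModel lam n).symm), ?_⟩
  refine isBlockToeplitz_compression _ hθ (e := fun i => (e i : L2))
    (e.orthonormal.comp_linearIsometry (Submodule.subtypeₗᵢ _)) (fun i => (e i).2) (fun p => ?_) ?_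
  · rw [OrthonormalBasis.map_apply, LinearIsometryEquiv.coe_ofEq_apply]
    exact hx p
  · simp only [coe_blaschkeUnitary_zpow]
    exact hϕ

end Blaschke

end SzegoModel

theorem theorem13 {d : ℕ} (hd : 0 < d) (lam : Fin d → 𝔻) (ϕ : L2) (hϕ : ϕ ∈ spaceM₁ lam) :
    (∃! a : ℤ → ℂ, HasSum (fun n : ℤ => a n • blaschkeLp lam n) ϕ) ∧
    ∀ a : ℤ → ℂ, HasSum (fun n : ℤ => a n • blaschkeLp lam n) ϕ →
      ∃ φ : L2, HasSum (fun n : ℤ => a n • (fourierLp 2 n : L2)) φ ∧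
        SingularDistributed lam ϕ (fun t => ‖φ t‖) ∧
        ((∀ᵐ t ∂arc, (ϕ t).im = 0) → EigenDistributed lam ϕ φ) := by
  obtain ⟨U, hU⟩ := exists_equiv_orthonormal_blaschkeLp lam hd
  refine ⟨existsUnique_hasSum_smul hU hϕ, fun a ha => ?_⟩
  have hsq : Summable fun n => ‖a n‖ ^ 2 := summable_norm_sq_of_hasSum_smul hU ha
  have hφ := ((summable_smul_iff_summable_norm_sq_of_orthonormal
    (orthonormal_fourier (T := 2 * Real.pi))).2 hsq).hasSum
  have : Nonempty (Fin (Module.finrank ℂ (blaschkeModel lam 1))) :=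
    Fin.pos_iff_nonempty.1 (finrank_blaschkeModel_one_pos lam hd)
  have hT (n : ℕ) [NeZero n] := exists_isBlockToeplitz_blaschkeCompression lam ha n
  exact ⟨_, hφ, fun G hG hc => tendsto_mean_singularValues_of_isBlockToeplitz hT hφ hG hc,
    fun hreal G hG hc => tendsto_mean_roots_of_isBlockToeplitz hT
      (fun n => compression_isSymmetric _ hreal) hφ hG hc⟩
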